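/- **Setting.** Let $K\ge 1$, $L$, $N$ be integers with $K\le L\le N-K$. Let $z_1,\dots,z_K\in\mathbb C$ be pairwise distinct nodes with $|z_k|\le 1$, let $\alpha_1,\dots,\alpha_K\in\mathbb C\setminus\{0\}$, let $e=(e_0,\dots,e_{N-1})\in\mathbb C^N$ be arbitrary (deterministic noise), and let $\tilde x_n=\sum_{k=1}^K\alpha_kz_k^n+e_n$ for $0\le n\le N-1$ (with $0^0=1$). Put $\alpha_{\min}=\min_k|\alpha_k|$, $\alpha_{\max}=\max_k|\alpha_k|$, $A_{\min}=\min_k|z_k|$. For $M\ge K$ let $V_M=(z_k^{\,i})_{0\le i\le M-1,\,1\le k\le K}\in\mathbb C^{M\times K}$ be the Vandermonde matrix. $\sigma_{\min},\sigma_{\max}$ denote the smallest and largest singular value of a matrix and $\kappa=\sigma_{\max}/\sigma_{\min}$. For a vector $(y_0,\dots,y_{n-1})$ let $\mathscr H_L(y_0,\dots,y_{n-1})=(y_{i+j})_{0\le i\le L-1,\,0\le j\le n-L}$. **Case 1 (LS-ESPRIT).** Assume $L\ge K+1$. Let $\tilde S\in\mathbb C^{L\times K}$ consist of the left singular vectors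 belonging to the $K$ largest singular values in a singular value decomposition of $\mathscr H_L(\tilde x_0,\dots,\tilde x_{N-1})$, let $\tilde S_\downarrow$ and $\tilde S_\uparrow$ be $\tilde S$ without its last and without its first row, respectively, and let $\hat z_1,\dots,\hat z_K$ be the eigenvalues (with algebraic multiplicity) of $\tilde S_\downarrow^\dagger\tilde S_\uparrow$, where $\dagger$ is the Moore–Penrose pseudoinverse. Put $\beta=\sigma_{\max}(V_L)/\sigma_{\min}(V_{L-1})$. If $$\gamma=\frac{\sqrt{\min\{L,N-L+1\}}\,\|e\|_2}{\alpha_{\min}\,\sigma_{\min}(V_L)\,\sigma_{\min}(V_{N-L+1})}<\frac1{1+\sqrt2\,\beta},$$ then there is a permutation $\pi$ of $\{1,\dots,K\}$ such that for all $k$ $$|\hat z_{\pi(k)}-z_k|\le\frac{(2K-1)\sqrt2\,\beta\gamma}{1-(1+\sqrt2\,\beta)\gamma}\,\bigl(1+\kappa(V_L)\bigr)\kappa(V_L).$$ **Case 2 (matrix pencil method).** Let $\tilde X_1=\mathscr H_L(\tilde x_0,\dots,\tilde x_{N-2})$ and $\tilde X_2=\mathscr H_L(\tilde x_1,\dots,\tilde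 x_{N-1})$, both in $\mathbb C^{L\times(N-L)}$, let $\tilde S_1\in\mathbb C^{L\times K}$ and $\tilde R_1\in\mathbb C^{(N-L)\times K}$ consist of the left and right singular vectors belonging to the $K$ largest singular values in a singular value decomposition of $\tilde X_1$, and let $\tilde\Psi_i=\tilde S_1^H\tilde X_i\tilde R_1$ for $i=1,2$. Assume that the pair $(\tilde\Psi_1,\tilde\Psi_2)$ is regular, i.e. $\det(a\tilde\Psi_1-b\tilde\Psi_2)\ne0$ for some $a,b\in\mathbb C$, and let $\hat z_1,\dots,\hat z_K\in\mathbb C\cup\{\infty\}$ be its generalized eigenvalues, i.e. the roots of $P(\lambda)=\det(\tilde\Psi_2-\lambda\tilde\Psi_1)$ with multiplicity, together with $\infty$ repeated $K-\deg P$ times. If $$\gamma=\frac{\sqrt{\min\{L,N-L\}}\,\|e\|_2}{\alpha_{\min}\,\sigma_{\min}(V_L)\,\sigma_{\min}(V_{N-L})}<1,$$ then there is a permutation $\pi$ of $\{1,\dots,K\}$ such that for all $k$ $$\chi(\hat z_{\pi(k)},z_k)\le\frac{(2K-1)\gamma}{\sqrt{1+A_{\min}^2}}\left[\frac{2\sqrt2}{1-\gamma}\,\frac{\alpha_{\max}}{\alpha_{\min}}\,\kappa(V_L)\,\kappa(V_{N-L})+\left(1+\frac{\sqrt2\,\gamma}{1-\gamma}\right)\right],$$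 where $\chi(z,w)=\dfrac{|z-w|}{\sqrt{1+|z|^2}\sqrt{1+|w|^2}}$ for $z,w\in\mathbb C$ and $\chi(\infty,z)=\dfrac1{\sqrt{1+|z|^2}}$ for $z\in\mathbb C$ is the chordal distance. -/

import Mathlib

open scoped Matrix OnePoint

namespace SubspaceMethods

noncomputable section

/-- The largest singular value of a matrix (singular values are listed in decreasing order,
starting with index `0`). -/
def sigmaMax {m n : ℕ} (A : Matrix (Fin m) (Fin n) ℂ) : ℝ :=
  (Matrix.toEuclideanLin A).singularValues 0

/-- The smallest of the `min m n` singular values of an `m × n` matrix. -/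
def sigmaMin {m n : ℕ} (A : Matrix (Fin m) (Fin n) ℂ) : ℝ :=
  (Matrix.toEuclideanLin A).singularValues (min m n - 1)

/-- The (spectral) condition number `σ_max / σ_min`. -/
def kappa {m n : ℕ} (A : Matrix (Fin m) (Fin n) ℂ) : ℝ :=
  sigmaMax A / sigmaMin A

/-- The `L × K` Vandermonde matrix whose `(i, k)` entry is `z_k ^ i`, `0 ≤ i < L`. -/
def vand {K : ℕ} (L : ℕ) (z : Fin K → ℂ) : Matrix (Fin L) (Fin K) ℂ :=
  Matrix.of fun i k => z k ^ (i : ℕ)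

/-- The `L × M` Hankel matrix `(x_{i+j})` of a vector of length `L + M - 1`. -/
def hankel {n : ℕ} (L M : ℕ) (h : L + M = n + 1) (x : Fin n → ℂ) : Matrix (Fin L) (Fin M) ℂ :=
  Matrix.of fun i j => x ⟨(i : ℕ) + (j : ℕ), by omega⟩

/-- The noisy samples `x̃_n = ∑_k α_k z_k ^ n + e_n`, `0 ≤ n < N`. -/
def measurements {K N : ℕ} (z α : Fin K → ℂ) (e : EuclideanSpace ℂ (Fin N)) : Fin N → ℂ :=
  fun n => ∑ k, α k * z k ^ (n : ℕ) + e n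

/-- The rectangular diagonal `m × n` matrix with diagonal entries `s 0, s 1, …`. -/
def rectDiag (m n : ℕ) (s : ℕ → ℝ) : Matrix (Fin m) (Fin n) ℂ :=
  Matrix.of fun i j => if (i : ℕ) = (j : ℕ) then ((s i : ℝ) : ℂ) else 0

/-- `A = U Σ Wᴴ` is a singular value decomposition of `A` whose first `K` diagonal entries are
the `K` largest singular values (no order is imposed within the two groups, and no choice is
imposed in case of ties). -/
structure IsSVD {m n : ℕ} (K : ℕ) (A : Matrix (Fin m) (Fin n) ℂ)
    (U : Matrix (Fin m) (Fin m) ℂ) (s : ℕ → ℝ) (W : Matrix (Fin n) (Fin n) ℂ) : Prop where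
  unitary_left : U ∈ Matrix.unitaryGroup (Fin m) ℂ
  unitary_right : W ∈ Matrix.unitaryGroup (Fin n) ℂ
  nonneg : ∀ i, i < min m n → 0 ≤ s i
  largest_first : ∀ i j, i < K → K ≤ j → j < min m n → s j ≤ s i
  eq_mul : A = U * rectDiag m n s * Wᴴ

/-- The first `K` columns of a matrix. -/
def firstCols {m n : ℕ} (K : ℕ) (h : K ≤ n) (A : Matrix (Fin m) (Fin n) ℂ) :
    Matrix (Fin m) (Fin K) ℂ :=
  Matrix.of fun i j => A i (Fin.castLE h j)

/-- All rows but the last one (the matrix marked with a down arrow). -/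
def rowsDown {L K : ℕ} (A : Matrix (Fin L) (Fin K) ℂ) : Matrix (Fin (L - 1)) (Fin K) ℂ :=
  Matrix.of fun i j => A ⟨(i : ℕ), by omega⟩ j

/-- All rows but the first one (the matrix marked with an up arrow). -/
def rowsUp {L K : ℕ} (A : Matrix (Fin L) (Fin K) ℂ) : Matrix (Fin (L - 1)) (Fin K) ℂ :=
  Matrix.of fun i j => A ⟨(i : ℕ) + 1, by omega⟩ j

/-- `G` is the Moore–Penrose pseudoinverse `A†` of `A`: the four Penrose equations, which have
exactly one solution `G`. -/
structure IsMoorePenrose {m n : ℕ} (A : Matrix (Fin m) (Fin n) ℂ)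
    (G : Matrix (Fin n) (Fin m) ℂ) : Prop where
  mul_mul_left : A * G * A = A
  mul_mul_right : G * A * G = G
  isHermitian_left : (A * G).IsHermitian
  isHermitian_right : (G * A).IsHermitian

/-- `w` lists the eigenvalues of `A`, counted with algebraic multiplicity. -/
def IsEigenvalueList {K : ℕ} (A : Matrix (Fin K) (Fin K) ℂ) (w : Fin K → ℂ) : Prop :=
  A.charpoly.roots = Finset.univ.val.map w

/-- `zhat` is an output of LS-ESPRIT for the data vector `x`, `K` nodes and window length `L`:
the eigenvalues of `S↓† S↑`, where `S` consists of the left singular vectors that belong to the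
`K` largest singular values of the `L × (N - L + 1)` Hankel matrix of `x`. -/
def IsEsprit {N : ℕ} (K L : ℕ) (hKL : K ≤ L) (hLN : L + K ≤ N) (x : Fin N → ℂ)
    (zhat : Fin K → ℂ) : Prop :=
  ∃ (U : Matrix (Fin L) (Fin L) ℂ) (s : ℕ → ℝ)
    (W : Matrix (Fin (N - L + 1)) (Fin (N - L + 1)) ℂ)
    (G : Matrix (Fin K) (Fin (L - 1)) ℂ),
    IsSVD K (hankel L (N - L + 1) (by omega) x) U s W ∧
    IsMoorePenrose (rowsDown (firstCols K hKL U)) G ∧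
    IsEigenvalueList (G * rowsUp (firstCols K hKL U)) zhat

/-- The samples `x_0, …, x_{N-2}`. -/
def dropLast {N : ℕ} (x : Fin N → ℂ) : Fin (N - 1) → ℂ := fun n => x ⟨(n : ℕ), by omega⟩

/-- The samples `x_1, …, x_{N-1}`. -/
def dropFirst {N : ℕ} (x : Fin N → ℂ) : Fin (N - 1) → ℂ := fun n => x ⟨(n : ℕ) + 1, by omega⟩

/-- The pair `(A, B)` is regular. -/
def IsRegularPair {K : ℕ} (A B : Matrix (Fin K) (Fin K) ℂ) : Prop :=
  ∃ a b : ℂ, (a • A - b • B).det ≠ 0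

/-- The polynomial `det (B - λ A)` in `λ`. -/
def pencilPoly {K : ℕ} (A B : Matrix (Fin K) (Fin K) ℂ) : Polynomial ℂ :=
  (B.map Polynomial.C - (Polynomial.X : Polynomial ℂ) • A.map Polynomial.C).det

/-- `w` lists the `K` generalized eigenvalues in `ℂ ∪ {∞}` of the regular pair `(A, B)`, i.e. of
`B y = λ A y`, counted with algebraic multiplicity: the roots of `det (B - λ A)`, and `∞` as
often as the degree of this polynomial falls short of `K`. -/
def IsGenEigenvalueList {K : ℕ} (A B : Matrix (Fin K) (Fin K) ℂ) (w : Fin K → OnePoint ℂ) :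
    Prop :=
  Finset.univ.val.map w =
    (pencilPoly A B).roots.map (fun c : ℂ => (c : OnePoint ℂ)) +
      Multiset.replicate (K - (pencilPoly A B).natDegree) (∞ : OnePoint ℂ)

/-- `zhat` is an output of the matrix pencil method for the data vector `x`, `K` nodes and
pencil parameter `L`, in a run in which the pair of compressed matrices
`(Ψ₁, Ψ₂) = (Sᴴ X₁ R, Sᴴ X₂ R)` is regular. Here `X₁`, `X₂` are the `L × (N - L)` Hankel matrices
of `x_0, …, x_{N-2}` and of `x_1, …, x_{N-1}`, and `S`, `R` consist of the left and right singular
vectors that belong to the `K` largest singular values of `X₁`. -/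
def IsRegularMP {N : ℕ} (K L : ℕ) (hK : 0 < K) (hKL : K ≤ L) (hLN : L + K ≤ N) (x : Fin N → ℂ)
    (zhat : Fin K → OnePoint ℂ) : Prop :=
  ∃ (U : Matrix (Fin L) (Fin L) ℂ) (s : ℕ → ℝ) (W : Matrix (Fin (N - L)) (Fin (N - L)) ℂ)
    (X₁ X₂ : Matrix (Fin L) (Fin (N - L)) ℂ) (Ψ₁ Ψ₂ : Matrix (Fin K) (Fin K) ℂ),
    X₁ = hankel L (N - L) (by omega) (dropLast x) ∧
    X₂ = hankel L (N - L) (by omega) (dropFirst x) ∧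
    IsSVD K X₁ U s W ∧
    Ψ₁ = (firstCols K hKL U)ᴴ * X₁ * firstCols K (by omega) W ∧
    Ψ₂ = (firstCols K hKL U)ᴴ * X₂ * firstCols K (by omega) W ∧
    IsRegularPair Ψ₁ Ψ₂ ∧
    IsGenEigenvalueList Ψ₁ Ψ₂ zhat

/-- The chordal distance on the extended complex plane. -/
def chordal : OnePoint ℂ → OnePoint ℂ → ℝ
  | OnePoint.some z, OnePoint.some w => ‖z - w‖ / (√(1 + ‖z‖ ^ 2) * √(1 + ‖w‖ ^ 2))
  | OnePoint.some z, ∞ => 1 / √(1 + ‖z‖ ^ 2)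
  | ∞, OnePoint.some w => 1 / √(1 + ‖w‖ ^ 2)
  | ∞, ∞ => 0

end

end SubspaceMethods

open SubspaceMethods

/-! The noise-free Hankel matrix factors as `V_L` times `diagonal α` times the transpose of a second
Vandermonde matrix (`hankel_exponential_sum`), and the noise part has norm at most `√(min L M) ‖e‖`
(`l2norm_hankel_mulVec_le`). So `γ` compares the noise with a lower bound for the `K`-th singular
value of the signal. By Weyl's inequality and a least-squares argument (`IsSVD.sub_le`,
`IsSVD.exists_projection`) the leading singular vectors split as `S = V T + R` with `R` orthogonal
to the range of `V` and `‖R‖ ≤ s = γ / (1 - γ)`, the sine of the largest angle; let `c = √(1 - s²)`.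

ESPRIT: by shift invariance the noise-free answer is `A = T⁻¹ diag(z) T`, and `G S↑ = A + G (R↑ - R↓
A)`. Since `T` has condition number at most `κ(V_L) / c`, a Bauer–Fike estimate bounds the
displacement (`exists_perm_esprit`); `esprit_bound_le` simplifies the constant.

Matrix pencil: compression gives `Ψᵢ = F Dᵢ G + noise`, with `F` and `G` bounded below by the cosine
times a smallest singular value. A null vector of the pencil then puts each eigenvalue in a small
chordal ball around some node (`exists_projDist_le`).

Both cases turn such inclusions into a matching, at the cost of the factor `2 K - 1`, by deforming
the noise to zero (`exists_perm_of_path`): roots move continuously and cannot leave a connected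
cluster of balls. For pencils, a point outside all the balls is first sent to infinity
(`exists_perm_projDist_le`). -/

namespace SubspaceMethods

/-! ### Euclidean norms and upper and lower bounds of matrices -/

section L2Norm

variable {ι κ : Type*} [Fintype ι] [Fintype κ]

/-- The Euclidean norm of a complex vector. -/
noncomputable def l2norm (v : ι → ℂ) : ℝ := ‖WithLp.toLp 2 v‖

lemma l2norm_nonneg (v : ι → ℂ) : 0 ≤ l2norm v := norm_nonneg _

lemma l2norm_sq (v : ι → ℂ) : l2norm v ^ 2 = ∑ i, ‖v i‖ ^ 2 :=
  EuclideanSpace.norm_sq_eq _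

lemma l2norm_add_le (v w : ι → ℂ) : l2norm (v + w) ≤ l2norm v + l2norm w := by
  simpa [l2norm] using norm_add_le (WithLp.toLp 2 v) (WithLp.toLp 2 w)

lemma l2norm_sub_le (v w : ι → ℂ) : l2norm (v - w) ≤ l2norm v + l2norm w := by
  simpa [l2norm] using norm_sub_le (WithLp.toLp 2 v) (WithLp.toLp 2 w)

lemma l2norm_sub_l2norm_le (v w : ι → ℂ) : l2norm v - l2norm w ≤ l2norm (v - w) := by
  simpa [l2norm] using norm_sub_norm_le (WithLp.toLp 2 v) (WithLp.toLp 2 w)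

lemma l2norm_smul (c : ℂ) (v : ι → ℂ) : l2norm (c • v) = ‖c‖ * l2norm v := by
  simpa [l2norm] using norm_smul c (WithLp.toLp 2 v)

@[simp] lemma l2norm_zero : l2norm (0 : ι → ℂ) = 0 := by simp [l2norm]

lemma l2norm_eq_zero {v : ι → ℂ} : l2norm v = 0 ↔ v = 0 := by simp [l2norm]

lemma l2norm_pos {v : ι → ℂ} (hv : v ≠ 0) : 0 < l2norm v :=
  (l2norm_nonneg v).lt_of_ne fun h => hv (l2norm_eq_zero.1 h.symm)

lemma l2norm_star (v : ι → ℂ) : l2norm (star v) = l2norm v := by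
  have : l2norm (star v) ^ 2 = l2norm v ^ 2 := by simp [l2norm_sq]
  exact (pow_left_inj₀ (l2norm_nonneg _) (l2norm_nonneg _) two_ne_zero).1 this

lemma norm_dotProduct_le (v w : ι → ℂ) : ‖star v ⬝ᵥ w‖ ≤ l2norm v * l2norm w := by
  have := norm_inner_le_norm (𝕜 := ℂ) (WithLp.toLp 2 v) (WithLp.toLp 2 w)
  rwa [EuclideanSpace.inner_toLp_toLp, dotProduct_comm] at this

lemma star_dotProduct_self (v : ι → ℂ) : star v ⬝ᵥ v = ((l2norm v ^ 2 : ℝ) : ℂ) := by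
  rw [l2norm_sq]
  simp [dotProduct, Complex.conj_mul']

lemma norm_star_dotProduct_self (v : ι → ℂ) : ‖star v ⬝ᵥ v‖ = l2norm v ^ 2 := by
  rw [star_dotProduct_self, Complex.norm_real, Real.norm_of_nonneg (sq_nonneg _)]

lemma star_dotProduct_mulVec (A : Matrix ι κ ℂ) (v : ι → ℂ) (w : κ → ℂ) :
    star v ⬝ᵥ A *ᵥ w = star (Aᴴ *ᵥ v) ⬝ᵥ w := by
  rw [Matrix.star_mulVec, Matrix.conjTranspose_conjTranspose, Matrix.dotProduct_mulVec]

lemma l2norm_add_sq {v w : ι → ℂ} (h : star v ⬝ᵥ w = 0) :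
    l2norm (v + w) ^ 2 = l2norm v ^ 2 + l2norm w ^ 2 := by
  have h' : star w ⬝ᵥ v = 0 := by
    rw [Matrix.star_dotProduct, h, star_zero]
  have := star_dotProduct_self (v + w)
  rw [star_add, add_dotProduct, dotProduct_add, dotProduct_add, h, h', star_dotProduct_self,
    star_dotProduct_self] at this
  have := congrArg Complex.re this
  simp only [Complex.add_re, Complex.ofReal_re, Complex.zero_re] at this
  linarith

lemma l2norm_mulVec_of_conjTranspose_mul_self [DecidableEq κ] {A : Matrix ι κ ℂ} (h : Aᴴ * A = 1)
    (v : κ → ℂ) : l2norm (A *ᵥ v) = l2norm v := by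
  have h1 := star_dotProduct_self (A *ᵥ v)
  rw [star_dotProduct_mulVec, Matrix.mulVec_mulVec, h, Matrix.one_mulVec,
    star_dotProduct_self] at h1
  exact ((pow_left_inj₀ (l2norm_nonneg _) (l2norm_nonneg _) two_ne_zero).1
    (Complex.ofReal_injective h1)).symm

/-- The adjoint of an isometric matrix is a contraction. -/
lemma l2norm_conjTranspose_mulVec_le [DecidableEq κ] {A : Matrix ι κ ℂ} (h : Aᴴ * A = 1)
    (v : ι → ℂ) : l2norm (Aᴴ *ᵥ v) ≤ l2norm v := by
  have h1 := norm_star_dotProduct_self (Aᴴ *ᵥ v)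
  rw [← star_dotProduct_mulVec] at h1
  have h2 := norm_dotProduct_le v (A *ᵥ (Aᴴ *ᵥ v))
  rw [h1, l2norm_mulVec_of_conjTranspose_mul_self h] at h2
  by_contra! h3
  nlinarith [l2norm_nonneg v]

/-- A lower bound of a square matrix is a lower bound of its adjoint. -/
lemma le_l2norm_conjTranspose_mulVec [DecidableEq κ] {A : Matrix κ κ ℂ} {m : ℝ} (hm : 0 < m)
    (h : ∀ x, m * l2norm x ≤ l2norm (A *ᵥ x)) (x : κ → ℂ) :
    m * l2norm x ≤ l2norm (Aᴴ *ᵥ x) := by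
  have hdet : A.det ≠ 0 := by
    intro h0
    obtain ⟨v, hv, hv0⟩ := Matrix.exists_mulVec_eq_zero_iff.2 h0
    have := h v
    rw [hv0, l2norm_zero] at this
    nlinarith [l2norm_pos hv]
  obtain ⟨y, rfl⟩ : ∃ y, A *ᵥ y = x :=
    ⟨A⁻¹ *ᵥ x, by rw [Matrix.mulVec_mulVec, Matrix.mul_nonsing_inv _ (Ne.isUnit hdet),
      Matrix.one_mulVec]⟩
  have h1 := norm_star_dotProduct_self (A *ᵥ y)
  rw [star_dotProduct_mulVec] at h1
  -- With `x = A y`: `‖x‖² = ⟨Aᴴ x, y⟩ ≤ ‖Aᴴ x‖ ‖y‖`, and `m ‖y‖ ≤ ‖x‖`.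
  have h2 := norm_dotProduct_le (Aᴴ *ᵥ (A *ᵥ y)) y
  rw [h1] at h2
  have h3 := h y
  rcases (l2norm_nonneg (A *ᵥ y)).eq_or_lt with h4 | h4
  · rw [← h4, mul_zero]; exact l2norm_nonneg _
  · have := mul_le_mul_of_nonneg_left h3 (l2norm_nonneg (Aᴴ *ᵥ (A *ᵥ y)))
    have h5 : m * l2norm (A *ᵥ y) * l2norm (A *ᵥ y) ≤
        l2norm (Aᴴ *ᵥ (A *ᵥ y)) * l2norm (A *ᵥ y) := by nlinarith
    exact le_of_mul_le_mul_right h5 h4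

/-- The adjoint of a matrix with lower bound `m` has the lower bound `m` on the range. -/
lemma le_l2norm_conjTranspose_mulVec_mulVec {A : Matrix ι κ ℂ} {m : ℝ}
    (h : ∀ x, m * l2norm x ≤ l2norm (A *ᵥ x)) (y : κ → ℂ) :
    m * l2norm (A *ᵥ y) ≤ l2norm (Aᴴ *ᵥ (A *ᵥ y)) := by
  have h1 := norm_star_dotProduct_self (A *ᵥ y)
  rw [star_dotProduct_mulVec] at h1
  have h2 := norm_dotProduct_le (Aᴴ *ᵥ (A *ᵥ y)) y
  rw [h1] at h2
  have h3 := h y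
  rcases (l2norm_nonneg (A *ᵥ y)).eq_or_lt with h4 | h4
  · rw [← h4, mul_zero]; exact l2norm_nonneg _
  · have := mul_le_mul_of_nonneg_left h3 (l2norm_nonneg (Aᴴ *ᵥ (A *ᵥ y)))
    by_cases hm : 0 ≤ m
    · have h5 : m * l2norm (A *ᵥ y) * l2norm (A *ᵥ y) ≤
          l2norm (Aᴴ *ᵥ (A *ᵥ y)) * l2norm (A *ᵥ y) := by nlinarith
      exact le_of_mul_le_mul_right h5 h4
    · exact (mul_nonpos_of_nonpos_of_nonneg (not_le.1 hm).le h4.le).trans (l2norm_nonneg _)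

lemma l2norm_diagonal_mulVec_le [DecidableEq κ] {d : κ → ℂ} {c : ℝ} (hc : 0 ≤ c)
    (h : ∀ i, ‖d i‖ ≤ c) (x : κ → ℂ) : l2norm (Matrix.diagonal d *ᵥ x) ≤ c * l2norm x := by
  refine le_of_sq_le_sq ?_ (mul_nonneg hc (l2norm_nonneg x))
  rw [mul_pow, l2norm_sq, l2norm_sq, Finset.mul_sum]
  refine Finset.sum_le_sum fun i _ => ?_
  rw [Matrix.mulVec_diagonal, norm_mul, mul_pow]
  gcongr
  exact h i

lemma le_l2norm_diagonal_mulVec [DecidableEq κ] {d : κ → ℂ} {c : ℝ} (hc : 0 ≤ c)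
    (h : ∀ i, c ≤ ‖d i‖) (x : κ → ℂ) : c * l2norm x ≤ l2norm (Matrix.diagonal d *ᵥ x) := by
  refine le_of_sq_le_sq ?_ (l2norm_nonneg _)
  rw [mul_pow, l2norm_sq, l2norm_sq, Finset.mul_sum]
  refine Finset.sum_le_sum fun i _ => ?_
  rw [Matrix.mulVec_diagonal, norm_mul, mul_pow]
  gcongr
  exact h i

end L2Norm

/-! ### Extreme singular values as operator bounds -/

section SingularValues

open Module InnerProductSpace

variable {E F : Type*} [NormedAddCommGroup E] [InnerProductSpace ℂ E] [FiniteDimensional ℂ E]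
  [NormedAddCommGroup F] [InnerProductSpace ℂ F] [FiniteDimensional ℂ F]

/-- Expand `⟪x, T* T x⟫` in an eigenbasis of `T* T`, whose eigenvalues are the squared singular
values. -/
lemma norm_apply_sq_eq_sum_singularValues (T : E →ₗ[ℂ] F) {n : ℕ} (hn : finrank ℂ E = n) (x : E) :
    ‖T x‖ ^ 2 = ∑ i : Fin n, T.singularValues i ^ 2 *
      ‖⟪T.isSymmetric_adjoint_comp_self.eigenvectorBasis hn i, x⟫_ℂ‖ ^ 2 := by
  set b := T.isSymmetric_adjoint_comp_self.eigenvectorBasis hn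
  have h1 : ((‖T x‖ ^ 2 : ℝ) : ℂ) = ⟪x, (LinearMap.adjoint T ∘ₗ T) x⟫_ℂ := by
    rw [LinearMap.comp_apply, LinearMap.adjoint_inner_right, inner_self_eq_norm_sq_to_K]
    simp
  have h2 : ⟪x, (LinearMap.adjoint T ∘ₗ T) x⟫_ℂ =
      ∑ i, ⟪x, b i⟫_ℂ * ⟪b i, (LinearMap.adjoint T ∘ₗ T) x⟫_ℂ := (b.sum_inner_mul_inner _ _).symm
  rw [h2] at h1
  apply Complex.ofReal_injective
  rw [h1, Complex.ofReal_sum]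
  refine Finset.sum_congr rfl fun i _ => ?_
  rw [← T.isSymmetric_adjoint_comp_self (b i) x,
    T.isSymmetric_adjoint_comp_self.apply_eigenvectorBasis hn i, T.sq_singularValues_fin hn i,
    inner_smul_left, ← inner_conj_symm x (b i)]
  have := Complex.conj_mul' ⟪b i, x⟫_ℂ
  simp only [Complex.coe_algebraMap, Complex.conj_ofReal, Complex.ofReal_mul, Complex.ofReal_pow]
  rw [← this]
  change _ * (_ * ⟪b i, x⟫_ℂ) = _
  simp
  ring

lemma norm_apply_le_singularValues_zero (T : E →ₗ[ℂ] F) (x : E) :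
    ‖T x‖ ≤ T.singularValues 0 * ‖x‖ := by
  refine le_of_sq_le_sq ?_ (mul_nonneg (T.singularValues_nonneg 0) (norm_nonneg x))
  rw [norm_apply_sq_eq_sum_singularValues T rfl, mul_pow,
    ← (T.isSymmetric_adjoint_comp_self.eigenvectorBasis rfl).sum_sq_norm_inner_right x,
    Finset.mul_sum]
  refine Finset.sum_le_sum fun i _ => ?_
  gcongr
  · exact T.singularValues_nonneg _
  · exact T.singularValues_antitone (Nat.zero_le _)

lemma singularValues_mul_norm_le (T : E →ₗ[ℂ] F) (x : E) :
    T.singularValues (finrank ℂ E - 1) * ‖x‖ ≤ ‖T x‖ := by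
  refine le_of_sq_le_sq ?_ (norm_nonneg _)
  rw [norm_apply_sq_eq_sum_singularValues T rfl, mul_pow,
    ← (T.isSymmetric_adjoint_comp_self.eigenvectorBasis rfl).sum_sq_norm_inner_right x,
    Finset.mul_sum]
  refine Finset.sum_le_sum fun i _ => ?_
  gcongr
  · exact T.singularValues_nonneg _
  · exact T.singularValues_antitone (by omega)

end SingularValues

lemma l2norm_mulVec_le_sigmaMax {m n : ℕ} (A : Matrix (Fin m) (Fin n) ℂ) (x : Fin n → ℂ) :
    l2norm (A *ᵥ x) ≤ sigmaMax A * l2norm x :=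
  norm_apply_le_singularValues_zero (Matrix.toEuclideanLin A) (WithLp.toLp 2 x)

/-- Tallness makes `min m n - 1` the last index for the domain; a wide matrix has a kernel and no
such bound in general. -/
lemma sigmaMin_mul_l2norm_le {m n : ℕ} (h : n ≤ m) (A : Matrix (Fin m) (Fin n) ℂ)
    (x : Fin n → ℂ) : sigmaMin A * l2norm x ≤ l2norm (A *ᵥ x) := by
  have := singularValues_mul_norm_le (Matrix.toEuclideanLin A) (WithLp.toLp 2 x)
  rw [finrank_euclideanSpace_fin] at this
  rwa [sigmaMin, min_eq_right h]

lemma sigmaMin_pos {m n : ℕ} (hn : 0 < n) (h : n ≤ m) {A : Matrix (Fin m) (Fin n) ℂ}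
    (hA : ∀ x, A *ᵥ x = 0 → x = 0) : 0 < sigmaMin A := by
  rw [sigmaMin, min_eq_right h]
  refine (LinearMap.injective_iff_forall_lt_finrank_singularValues_pos _).1 ?_ _ ?_
  · rw [injective_iff_map_eq_zero]
    intro x hx
    have : A *ᵥ x.ofLp = 0 := by
      have := congrArg WithLp.ofLp hx
      simpa using this
    have := hA _ this
    ext i
    simpa using congrFun this i
  · rw [finrank_euclideanSpace_fin]; omega

/-- The first `K` rows already form an invertible square Vandermonde matrix. -/
lemma vand_mulVec_eq_zero {K L : ℕ} (hKL : K ≤ L) {z : Fin K → ℂ} (hz : Function.Injective z)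
    {x : Fin K → ℂ} (hx : vand L z *ᵥ x = 0) : x = 0 := by
  have hdet : (Matrix.vandermonde z)ᵀ.det ≠ 0 := by
    rw [Matrix.det_transpose]; exact Matrix.det_vandermonde_ne_zero_iff.2 hz
  refine Matrix.eq_zero_of_mulVec_eq_zero hdet ?_
  ext i
  have := congrFun hx (Fin.castLE hKL i)
  simpa [vand, Matrix.mulVec, dotProduct, Matrix.vandermonde] using this

lemma sigmaMin_vand_pos {K L : ℕ} (hK : 0 < K) (hKL : K ≤ L) {z : Fin K → ℂ}
    (hz : Function.Injective z) : 0 < sigmaMin (vand L z) :=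
  sigmaMin_pos hK hKL fun _ => vand_mulVec_eq_zero hKL hz

lemma sigmaMin_le_sigmaMax {m n : ℕ} (A : Matrix (Fin m) (Fin n) ℂ) : sigmaMin A ≤ sigmaMax A :=
  LinearMap.singularValues_antitone _ (Nat.zero_le _)

/-! ### Matching roots along a path of polynomials -/

section Matching

/-- Equal multiplicities mean equinumerous fibres; bijections between the fibres glue to a
permutation. -/
lemma exists_perm_of_map_univ_eq {ι α : Type*} [Fintype ι] {v w : ι → α}
    (h : Finset.univ.val.map v = Finset.univ.val.map w) : ∃ σ : Equiv.Perm ι, w ∘ σ = v := by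
  classical
  have hc : ∀ c, Fintype.card {i // v i = c} = Fintype.card {i // w i = c} := by
    intro c
    have := congrArg (Multiset.count c) h
    rw [Multiset.count_map, Multiset.count_map] at this
    rw [Fintype.card_subtype, Fintype.card_subtype]
    simpa [Finset.card, Finset.filter, eq_comm] using this
  refine ⟨Equiv.ofFiberEquiv fun c => Fintype.equivOfCardEq (hc c), ?_⟩
  ext i
  exact Equiv.ofFiberEquiv_map _ i

lemma exists_perm_of_prod_sub_eq {K : ℕ} {v w : Fin K → ℂ}
    (h : ∀ x, ∏ i, (x - v i) = ∏ i, (x - w i)) : ∃ σ : Equiv.Perm (Fin K), w ∘ σ = v := by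
  have h1 : ∏ i, (Polynomial.X - Polynomial.C (v i)) =
      ∏ i, (Polynomial.X - Polynomial.C (w i)) := by
    refine Polynomial.funext fun x => ?_
    simpa [Polynomial.eval_prod] using h x
  have h2 : ∀ u : Fin K → ℂ, (∏ i, (Polynomial.X - Polynomial.C (u i))).roots =
      Finset.univ.val.map u := by
    intro u
    have := Polynomial.roots_multiset_prod_X_sub_C (Finset.univ.val.map u)
    rwa [Multiset.map_map] at this
  exact exists_perm_of_map_univ_eq (by rw [← h2 v, ← h2 w, h1])

/-- The graph on the indices of `z` that joins points at distance at most `ρ`. -/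
def proximityGraph {K : ℕ} (d : ℂ → ℂ → ℝ) (z : Fin K → ℂ) (ρ : ℝ) : SimpleGraph (Fin K) :=
  SimpleGraph.fromRel fun i j => d (z i) (z j) ≤ ρ

variable {K : ℕ} {d : ℂ → ℂ → ℝ}

lemma le_length_mul_of_walk (hd0 : ∀ x, d x x = 0) (hdsymm : ∀ x y, d x y = d y x)
    (hdtri : ∀ x y w, d x w ≤ d x y + d y w) {z : Fin K → ℂ} {ρ : ℝ} {i j : Fin K}
    (p : (proximityGraph d z ρ).Walk i j) : d (z i) (z j) ≤ p.length * ρ := by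
  induction p with
  | nil => simp [hd0]
  | @cons u v w h p ih =>
    rw [SimpleGraph.Walk.length_cons, Nat.cast_succ, add_mul, one_mul]
    have : d (z u) (z v) ≤ ρ := by
      rcases ((SimpleGraph.fromRel_adj _ _ _).1 h).2 with h | h
      · exact h
      · rwa [hdsymm]
    linarith [hdtri (z u) (z v) (z w)]

/-- A walk without repeated vertices has at most `K - 1` edges, each of length at most `ρ`. -/
lemma le_mul_of_reachable (hd0 : ∀ x, d x x = 0) (hdsymm : ∀ x y, d x y = d y x)
    (hdtri : ∀ x y w, d x w ≤ d x y + d y w) {z : Fin K → ℂ} {ρ : ℝ} (hρ : 0 ≤ ρ) {i j : Fin K}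
    (h : (proximityGraph d z ρ).Reachable i j) : d (z i) (z j) ≤ ((K : ℝ) - 1) * ρ := by
  classical
  obtain ⟨p⟩ := h
  refine (le_length_mul_of_walk hd0 hdsymm hdtri p.bypass).trans ?_
  have h1 := (p.bypass_isPath).length_lt
  rw [Fintype.card_fin] at h1
  have h2 : ((p.bypass.length + 1 : ℕ) : ℝ) ≤ K := by exact_mod_cast h1
  push_cast at h2
  exact mul_le_mul_of_nonneg_right (by linarith) hρ

lemma reachable_of_le {z : Fin K → ℂ} {ρ : ℝ} {i j : Fin K} (h : d (z i) (z j) ≤ ρ) :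
    (proximityGraph d z ρ).Reachable i j := by
  by_cases hij : i = j
  · rw [hij]
  · exact (SimpleGraph.Adj.reachable ((SimpleGraph.fromRel_adj _ _ _).2 ⟨hij, Or.inl h⟩))

/-- The set is the projection of a closed set of pairs `(t, v)`. The bound `R` confines `v` to a
compact set, so the projection is closed. This replaces a continuous choice of roots. -/
lemma isClosed_setOf_exists_roots {f : unitInterval → ℂ → ℂ}
    (hf : Continuous fun p : unitInterval × ℂ => f p.1 p.2)
    (hd : Continuous fun p : ℂ × ℂ => d p.1 p.2) (z : Fin K → ℂ) (r R : ℝ)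
    (hR : ∀ x k, d x (z k) ≤ r → ‖x‖ ≤ R) (ψ : Fin K → Fin K) :
    IsClosed {t : unitInterval | ∃ v : Fin K → ℂ, (∀ x, f t x = ∏ i, (x - v i)) ∧
      ∀ i, d (v i) (z (ψ i)) ≤ r} := by
  let S : Set (unitInterval × (Fin K → ℂ)) :=
    {p | (∀ x, f p.1 x = ∏ i, (x - p.2 i)) ∧ ∀ i, d (p.2 i) (z (ψ i)) ≤ r}
  have hS : IsClosed S := by
    have : S = (⋂ x, {p | f p.1 x = ∏ i, (x - p.2 i)}) ∩ ⋂ i, {p | d (p.2 i) (z (ψ i)) ≤ r} := by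
      ext p
      simp [S]
    rw [this]
    refine IsClosed.inter (isClosed_iInter fun x => isClosed_eq ?_ (by fun_prop))
      (isClosed_iInter fun i => isClosed_le ?_ continuous_const)
    · exact hf.comp (by fun_prop : Continuous fun p : unitInterval × (Fin K → ℂ) => (p.1, x))
    · exact hd.comp (by fun_prop :
        Continuous fun p : unitInterval × (Fin K → ℂ) => (p.2 i, z (ψ i)))
  have hc : IsCompact S := by
    refine (isCompact_univ.prod (isCompact_univ_pi fun _ : Fin K =>
      isCompact_closedBall (0 : ℂ) R)).of_isClosed_subset hS fun p hp => ⟨Set.mem_univ _, ?_⟩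
    intro i _
    rw [mem_closedBall_zero_iff]
    exact hR _ _ (hp.2 i)
  convert (hc.image continuous_fst).isClosed using 1
  ext t
  constructor
  · rintro ⟨v, hv⟩; exact ⟨(t, v), hv, rfl⟩
  · rintro ⟨⟨t', v⟩, hv, rfl⟩; exact ⟨v, hv⟩

/-- Let the zeros of a continuous path of monic polynomials of degree `K` stay within `r` of the
zeros `z` of the first polynomial. Then the zeros of the last polynomial can be matched with `z`
up to `(2 K - 1) r`. -/
theorem exists_perm_of_path (hd : Continuous fun p : ℂ × ℂ => d p.1 p.2) (hd0 : ∀ x, d x x = 0)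
    (hdsymm : ∀ x y, d x y = d y x) (hdtri : ∀ x y w, d x w ≤ d x y + d y w)
    {z w : Fin K → ℂ} {r R : ℝ} (hr : 0 ≤ r) (hR : ∀ x k, d x (z k) ≤ r → ‖x‖ ≤ R)
    {f : unitInterval → ℂ → ℂ} (hf : Continuous fun p : unitInterval × ℂ => f p.1 p.2)
    (hroots : ∀ t, ∃ v : Fin K → ℂ, ∀ x, f t x = ∏ i, (x - v i))
    (hf0 : ∀ x, f 0 x = ∏ i, (x - z i)) (hf1 : ∀ x, f 1 x = ∏ i, (x - w i))
    (hclose : ∀ t x, f t x = 0 → ∃ k, d x (z k) ≤ r) :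
    ∃ π : Equiv.Perm (Fin K), ∀ k, d (w (π k)) (z k) ≤ (2 * (K : ℝ) - 1) * r := by
  let G := proximityGraph d z (2 * r)
  let B : (Fin K → Fin K) → Set unitInterval := fun ψ =>
    {t | ∃ v : Fin K → ℂ, (∀ x, f t x = ∏ i, (x - v i)) ∧ ∀ i, d (v i) (z (ψ i)) ≤ r}
  have hB : ∀ ψ, IsClosed (B ψ) := isClosed_setOf_exists_roots hf hd z r R hR
  -- A labelling `ψ` sends each root to a node within `r`. It is good if it becomes a permutation
  -- after moving labels inside connected components of the `2 r`-graph.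
  let good : Set (Fin K → Fin K) := {ψ | ∃ σ : Equiv.Perm (Fin K), ∀ i, G.Reachable (ψ i) (σ i)}
  have hcover : ∀ (t : unitInterval) (v : Fin K → ℂ), (∀ x, f t x = ∏ i, (x - v i)) → ∃ ψ : Fin K → Fin K,
      ∀ i, d (v i) (z (ψ i)) ≤ r := by
    intro t v hv
    have : ∀ i, ∃ k, d (v i) (z k) ≤ r := fun i =>
      hclose t (v i) (by rw [hv]; exact Finset.prod_eq_zero (Finset.mem_univ i) (sub_self _))
    exact ⟨fun i => (this i).choose, fun i => (this i).choose_spec⟩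
  have hgood : ∀ t ψ ψ', t ∈ B ψ → t ∈ B ψ' → ψ ∈ good → ψ' ∈ good := by
    rintro t ψ ψ' ⟨v, hv, hvψ⟩ ⟨v', hv', hvψ'⟩ ⟨σ, hσ⟩
    obtain ⟨τ, rfl⟩ := exists_perm_of_prod_sub_eq (fun x => (hv' x).symm.trans (hv x))
    -- Two labels of the same root are nodes at distance at most `r + r`, hence in one component; so
    -- goodness does not depend on the labelling.
    refine ⟨τ.trans σ, fun i => .trans (reachable_of_le ?_) (hσ (τ i))⟩
    have h1 := hdtri (z (ψ' i)) (v (τ i)) (z (ψ (τ i)))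
    rw [hdsymm (z (ψ' i)) (v (τ i))] at h1
    have h2 := hvψ' i
    simp only [Function.comp_apply] at h2
    linarith [hvψ (τ i)]
  -- Times with good labellings and times with bad ones are complementary finite unions of closed
  -- sets; time `0` is good, and the interval is connected.
  have hclopen : IsClopen (⋃ ψ ∈ good, B ψ) := by
    refine ⟨Set.toFinite _ |>.isClosed_biUnion fun ψ _ => hB ψ, ?_⟩
    have : (⋃ ψ ∈ good, B ψ) = (⋃ ψ ∈ goodᶜ, B ψ)ᶜ := by
      ext t
      simp only [Set.mem_iUnion, Set.mem_compl_iff, not_exists, exists_prop, not_and]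
      constructor
      · rintro ⟨ψ, hψ, ht⟩ ψ' hψ' ht'
        exact hψ' (hgood t ψ ψ' ht ht' hψ)
      · intro h
        obtain ⟨v, hv⟩ := hroots t
        obtain ⟨ψ, hψ⟩ := hcover t v hv
        refine ⟨ψ, ?_, v, hv, hψ⟩
        by_contra hn
        exact h ψ hn ⟨v, hv, hψ⟩
    rw [this]
    exact (Set.toFinite _ |>.isClosed_biUnion fun ψ _ => hB ψ).isOpen_compl
  have huniv : (⋃ ψ ∈ good, B ψ) = Set.univ := by
    refine hclopen.eq_univ ⟨0, Set.mem_biUnion (x := id) ⟨1, fun i => .refl _⟩ ⟨z, hf0, ?_⟩⟩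
    intro i
    rw [id, hd0]
    exact hr
  have h1 : (1 : unitInterval) ∈ ⋃ ψ ∈ good, B ψ := huniv ▸ Set.mem_univ _
  simp only [Set.mem_iUnion, exists_prop] at h1
  obtain ⟨ψ, ⟨σ, hσ⟩, v, hv, hψ⟩ := h1
  obtain ⟨τ, rfl⟩ := exists_perm_of_prod_sub_eq (fun x => (hv x).symm.trans (hf1 x))
  refine ⟨σ.symm.trans τ, fun k => ?_⟩
  have h2 := hψ (σ.symm k)
  -- At most `(K - 1) · 2 r` inside the component, plus `r` from root to label: `(2 K - 1) r` in
  -- total.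
  have h3 := le_mul_of_reachable hd0 hdsymm hdtri (by linarith) (hσ (σ.symm k))
  rw [Equiv.apply_symm_apply] at h3
  have h4 := hdtri (w (τ (σ.symm k))) (z (ψ (σ.symm k))) (z k)
  simp only [Function.comp_apply] at h2
  simp only [Equiv.trans_apply]
  linarith

end Matching

/-! ### Perturbation of singular values and singular subspaces -/

section SVD

variable {m n K : ℕ}

lemma rectDiag_mulVec (s : ℕ → ℝ) (q : Fin n → ℂ) (i : Fin m) :
    (rectDiag m n s *ᵥ q) i = if h : (i : ℕ) < n then (s i : ℂ) * q ⟨i, h⟩ else 0 := by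
  simp only [rectDiag, Matrix.mulVec, dotProduct, Matrix.of_apply, ite_mul, zero_mul]
  split_ifs with h
  · rw [Finset.sum_eq_single ⟨i, h⟩]
    · simp
    · intro j _ hj
      rw [if_neg]
      rintro h'
      exact hj (Fin.ext h'.symm)
    · simp
  · refine Finset.sum_eq_zero fun j _ => if_neg ?_
    have := j.2
    omega

lemma l2norm_rectDiag_mulVec_le {s : ℕ → ℝ} {q : Fin n → ℂ} {c : ℝ} (hc : 0 ≤ c)
    (h : ∀ j : Fin n, (j : ℕ) < m → q j ≠ 0 → |s j| ≤ c) :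
    l2norm (rectDiag m n s *ᵥ q) ≤ c * l2norm q := by
  refine le_of_sq_le_sq ?_ (mul_nonneg hc (l2norm_nonneg _))
  -- Extension by zero lets sums over `m` and over `n` indices be compared inside `range (max m n)`.
  let g : ℕ → ℝ := fun k => if h : k < n then ‖q ⟨k, h⟩‖ ^ 2 else 0
  have hg : ∀ k, 0 ≤ g k := by
    intro k
    simp only [g]
    split_ifs <;> positivity
  have h1 : l2norm q ^ 2 = ∑ k ∈ Finset.range n, g k := by
    rw [l2norm_sq, ← Fin.sum_univ_eq_sum_range g n]
    exact Finset.sum_congr rfl fun k _ => by simp [g]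
  have h2 : l2norm (rectDiag m n s *ᵥ q) ^ 2 ≤ ∑ k ∈ Finset.range m, c ^ 2 * g k := by
    rw [l2norm_sq, ← Fin.sum_univ_eq_sum_range (fun k => c ^ 2 * g k) m]
    refine Finset.sum_le_sum fun i _ => ?_
    rw [rectDiag_mulVec]
    simp only [g]
    split_ifs with hi
    · rw [norm_mul, mul_pow]
      by_cases hq : q ⟨i, hi⟩ = 0
      · simp [hq]
      · gcongr
        rw [Complex.norm_real]
        exact h ⟨i, hi⟩ i.2 hq
    · simp
  have h3 : ∑ k ∈ Finset.range (max m n), g k = ∑ k ∈ Finset.range n, g k := by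
    refine (Finset.sum_subset (Finset.range_mono (le_max_right _ _)) fun k _ hk => ?_).symm
    simp only [g]
    exact dif_neg (by simpa using hk)
  rw [mul_pow, h1, ← h3, Finset.mul_sum]
  exact h2.trans (Finset.sum_le_sum_of_subset_of_nonneg (Finset.range_mono (le_max_left _ _))
    fun k _ _ => mul_nonneg (sq_nonneg _) (hg k))

lemma firstCols_conjTranspose_mul_self (h : K ≤ n) {U : Matrix (Fin n) (Fin n) ℂ}
    (hU : U ∈ Matrix.unitaryGroup (Fin n) ℂ) : (firstCols K h U)ᴴ * firstCols K h U = 1 := by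
  have h1 : Uᴴ * U = 1 := Matrix.mem_unitaryGroup_iff'.1 hU
  ext i j
  have := congrFun (congrFun h1 (Fin.castLE h i)) (Fin.castLE h j)
  simpa [firstCols, Matrix.mul_apply, Matrix.one_apply] using this

lemma mul_firstCols {p : ℕ} (h : K ≤ n) (A : Matrix (Fin m) (Fin p) ℂ)
    (B : Matrix (Fin p) (Fin n) ℂ) :
    A * firstCols K h B = firstCols K h (A * B) := rfl

namespace IsSVD

variable {A : Matrix (Fin m) (Fin n) ℂ} {U : Matrix (Fin m) (Fin m) ℂ} {s : ℕ → ℝ}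
  {W : Matrix (Fin n) (Fin n) ℂ}

lemma conjTranspose (h : IsSVD K A U s W) : IsSVD K Aᴴ W s U where
  unitary_left := h.unitary_right
  unitary_right := h.unitary_left
  nonneg i hi := h.nonneg i (by rwa [min_comm])
  largest_first i j hi hj hij := h.largest_first i j hi hj (by rwa [min_comm])
  eq_mul := by
    have : (rectDiag m n s)ᴴ = rectDiag n m s := by
      ext i j
      simp only [rectDiag, Matrix.conjTranspose_apply, Matrix.of_apply]
      by_cases hij : (i : ℕ) = j
      · rw [if_pos hij.symm, if_pos hij, hij]; simp
      · rw [if_neg (Ne.symm hij), if_neg hij, star_zero]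
    rw [h.eq_mul, Matrix.conjTranspose_mul, Matrix.conjTranspose_mul,
      Matrix.conjTranspose_conjTranspose, this, Matrix.mul_assoc]

lemma mul_firstCols (h : IsSVD K A U s W) (hm : K ≤ m) (hn : K ≤ n) :
    A * firstCols K hn W = firstCols K hm U * Matrix.diagonal fun j : Fin K => (s j : ℂ) := by
  have h1 : Wᴴ * W = 1 := Matrix.mem_unitaryGroup_iff'.1 h.unitary_right
  have h2 : firstCols K hn (rectDiag m n s) =
      firstCols K hm 1 * Matrix.diagonal fun j : Fin K => (s j : ℂ) := by
    ext i j
    rw [Matrix.mul_diagonal]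
    simp only [firstCols, rectDiag, Matrix.of_apply, Matrix.one_apply, Fin.ext_iff, Fin.val_castLE]
    by_cases hij : (i : ℕ) = j
    · simp [hij]
    · simp [hij]
  calc A * firstCols K hn W = U * rectDiag m n s * Wᴴ * firstCols K hn W := by rw [← h.eq_mul]
    _ = U * firstCols K hn (rectDiag m n s) := by
        rw [SubspaceMethods.mul_firstCols, SubspaceMethods.mul_firstCols, Matrix.mul_assoc, h1,
          Matrix.mul_one]
    _ = _ := by
        rw [h2, ← Matrix.mul_assoc, SubspaceMethods.mul_firstCols, Matrix.mul_one]

/-- Weyl's inequality: the first `K` singular values of a perturbation of a matrix that is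
bounded below by `σ` on a `K`-dimensional space. -/
lemma sub_le {X E : Matrix (Fin m) (Fin n) ℂ} (h : IsSVD K (X + E) U s W) (hm : K ≤ m)
    (hn : K ≤ n) {V : Matrix (Fin n) (Fin K) ℂ} {σ ε : ℝ} (hV : ∀ y, V *ᵥ y = 0 → y = 0)
    (hX : ∀ y, σ * l2norm (V *ᵥ y) ≤ l2norm (X *ᵥ (V *ᵥ y)))
    (hE : ∀ u, l2norm (E *ᵥ u) ≤ ε * l2norm u) (i : Fin K) : σ - ε ≤ s i := by
  have hU : Uᴴ * U = 1 := Matrix.mem_unitaryGroup_iff'.1 h.unitary_left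
  have hW : Wᴴᴴ * Wᴴ = 1 := by
    rw [Matrix.conjTranspose_conjTranspose]
    exact Matrix.mem_unitaryGroup_iff.1 h.unitary_right
  -- Zeroing row `i` produces a nonzero `u` in the range of `V` orthogonal to the right singular
  -- vectors `j < K`, `j ≠ i`. The remaining ones have singular value at most `s i`. Row `i` is
  -- singled out since the leading `s j` are unordered.
  let B : Matrix (Fin K) (Fin K) ℂ := Matrix.of fun a b =>
    if a = i then 0 else (Wᴴ * V) (Fin.castLE hn a) b
  have hB : B.det = 0 := Matrix.det_eq_zero_of_row_eq_zero i fun j => by simp [B]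
  obtain ⟨y, hy, hBy⟩ := Matrix.exists_mulVec_eq_zero_iff.2 hB
  set u := V *ᵥ y with hu
  have hu0 : 0 < l2norm u := l2norm_pos fun h0 => hy (hV y h0)
  have hq : ∀ j : Fin n, (j : ℕ) < K → (j : ℕ) ≠ i → (Wᴴ *ᵥ u) j = 0 := by
    intro j hj hji
    have h1 := congrFun hBy ⟨j, hj⟩
    have h2 : (⟨j, hj⟩ : Fin K) ≠ i := fun h3 => hji (by rw [← h3])
    rw [hu, Matrix.mulVec_mulVec]
    simpa [B, Matrix.mulVec, dotProduct, h2] using h1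
  have hi : (i : ℕ) < min m n := lt_min (i.2.trans_le hm) (i.2.trans_le hn)
  have h1 : l2norm ((X + E) *ᵥ u) ≤ s i * l2norm u := by
    rw [h.eq_mul, ← Matrix.mulVec_mulVec, ← Matrix.mulVec_mulVec,
      l2norm_mulVec_of_conjTranspose_mul_self hU, ← l2norm_mulVec_of_conjTranspose_mul_self hW u]
    refine l2norm_rectDiag_mulVec_le (h.nonneg i hi) fun j hj hqj => ?_
    have hj' : (j : ℕ) < min m n := lt_min hj j.2
    rw [abs_of_nonneg (h.nonneg j hj')]
    by_cases hjK : (j : ℕ) < K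
    · by_cases hji : (j : ℕ) = i
      · rw [hji]
      · exact absurd (hq j hjK hji) hqj
    · exact h.largest_first i j i.2 (not_lt.1 hjK) hj'
  have h2 := l2norm_sub_le ((X + E) *ᵥ u) (E *ᵥ u)
  rw [← Matrix.sub_mulVec, add_sub_cancel_right] at h2
  have h3 := hX y
  have h4 := hE u
  have : (σ - ε) * l2norm u ≤ s i * l2norm u := by rw [← hu] at h3; linarith
  exact le_of_mul_le_mul_right this hu0

/-- A `sin Θ` theorem: the orthogonal projection `V₁ T` of the leading left singular vectors of a
perturbation of `V₁ D V₂ᴴ` onto the range of `V₁`. -/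
theorem exists_projection {V₁ : Matrix (Fin m) (Fin K) ℂ} {V₂ : Matrix (Fin n) (Fin K) ℂ}
    {D : Fin K → ℂ} {E : Matrix (Fin m) (Fin n) ℂ}
    (h : IsSVD K (V₁ * Matrix.diagonal D * V₂ᴴ + E) U s W) (hm : K ≤ m) (hn : K ≤ n)
    {m₁ m₂ a γ : ℝ} (hm₁ : 0 < m₁) (hm₂ : 0 < m₂) (ha : 0 < a)
    (hV₁ : ∀ y, m₁ * l2norm y ≤ l2norm (V₁ *ᵥ y)) (hV₂ : ∀ y, m₂ * l2norm y ≤ l2norm (V₂ *ᵥ y))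
    (hD : ∀ k, a ≤ ‖D k‖) (hγ0 : 0 ≤ γ) (hγ : γ < 1)
    (hE : ∀ u, l2norm (E *ᵥ u) ≤ γ * (a * m₁ * m₂) * l2norm u) :
    ∃ T : Matrix (Fin K) (Fin K) ℂ, V₁ᴴ * (firstCols K hm U - V₁ * T) = 0 ∧
      ∀ x, l2norm ((firstCols K hm U - V₁ * T) *ᵥ x) ≤ γ / (1 - γ) * l2norm x := by
  have hinj : ∀ {p : ℕ} {V : Matrix (Fin p) (Fin K) ℂ} {c : ℝ}, 0 < c →
      (∀ y, c * l2norm y ≤ l2norm (V *ᵥ y)) → ∀ y, V *ᵥ y = 0 → y = 0 := by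
    intro p V c hc hV y hy
    have := hV y
    rw [hy, l2norm_zero] at this
    exact l2norm_eq_zero.1 (le_antisymm (by nlinarith [l2norm_nonneg y]) (l2norm_nonneg y))
  have hσ : 0 < a * m₁ * m₂ := by positivity
  have hs : ∀ i : Fin K, (1 - γ) * (a * m₁ * m₂) ≤ s i := by
    intro i
    have := h.sub_le hm hn (hinj hm₂ hV₂) (σ := a * m₁ * m₂) (fun y => ?_) hE i
    · linarith
    · rw [← Matrix.mulVec_mulVec, ← Matrix.mulVec_mulVec]
      have h1 := le_l2norm_conjTranspose_mulVec_mulVec hV₂ y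
      have h2 := le_l2norm_diagonal_mulVec ha.le hD (V₂ᴴ *ᵥ (V₂ *ᵥ y))
      have h3 := hV₁ (Matrix.diagonal D *ᵥ (V₂ᴴ *ᵥ (V₂ *ᵥ y)))
      have h4 := mul_le_mul_of_nonneg_left h2 hm₁.le
      have h5 := mul_le_mul_of_nonneg_left h1 (mul_pos hm₁ ha).le
      linarith
  have hs0 : ∀ i : Fin K, 0 < s i := fun i => (mul_pos (by linarith) hσ).trans_le (hs i)
  have hdet : (V₁ᴴ * V₁).det ≠ 0 := by
    intro h0
    obtain ⟨v, hv, hv0⟩ := Matrix.exists_mulVec_eq_zero_iff.2 h0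
    rw [← Matrix.mulVec_mulVec] at hv0
    have h1 := le_l2norm_conjTranspose_mulVec_mulVec hV₁ v
    rw [hv0, l2norm_zero] at h1
    have h2 := l2norm_pos hv
    have h3 := hV₁ v
    nlinarith [mul_pos hm₁ h2]
  set S := firstCols K hm U
  -- The least-squares solution, from the normal equations.
  let T := (V₁ᴴ * V₁)⁻¹ * (V₁ᴴ * S)
  have hT : V₁ᴴ * (S - V₁ * T) = 0 := by
    rw [Matrix.mul_sub, ← Matrix.mul_assoc, ← Matrix.mul_assoc (V₁ᴴ * V₁),
      Matrix.mul_nonsing_inv _ (Ne.isUnit hdet), Matrix.one_mul, sub_self]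
  refine ⟨T, hT, fun x => ?_⟩
  -- Dividing by the singular values gives a preimage `w` of `S x` under the noisy matrix, of norm
  -- at most `‖x‖ / ((1 - γ) a m₁ m₂)`.
  let y : Fin K → ℂ := fun j => x j / s j
  let w := firstCols K hn W *ᵥ y
  have hSx : S *ᵥ x = (V₁ * Matrix.diagonal D * V₂ᴴ + E) *ᵥ w := by
    rw [Matrix.mulVec_mulVec, h.mul_firstCols hm hn, ← Matrix.mulVec_mulVec]
    congr 1
    ext j
    rw [Matrix.mulVec_diagonal]
    have : (s j : ℂ) ≠ 0 := Complex.ofReal_ne_zero.2 (hs0 j).ne'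
    simp only [y]
    field_simp
  have hw : l2norm w ≤ l2norm x / ((1 - γ) * (a * m₁ * m₂)) := by
    rw [l2norm_mulVec_of_conjTranspose_mul_self
      (firstCols_conjTranspose_mul_self hn h.unitary_right)]
    have h1 : y = Matrix.diagonal (fun j : Fin K => ((s j)⁻¹ : ℂ)) *ᵥ x := by
      ext j
      rw [Matrix.mulVec_diagonal]
      simp only [y]
      ring
    rw [h1, div_eq_inv_mul]
    refine l2norm_diagonal_mulVec_le (inv_nonneg.2 (mul_pos (by linarith) hσ).le) (fun j => ?_) x
    rw [norm_inv, Complex.norm_real, Real.norm_of_nonneg (hs0 j).le]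
    exact inv_anti₀ (mul_pos (by linarith) hσ) (hs j)
  -- `E w` is the difference of `S x` and a vector in the range of `V₁`; the orthogonal projection
  -- does at least as well.
  have hbest : l2norm ((S - V₁ * T) *ᵥ x) ≤ l2norm (E *ᵥ w) := by
    let v := Matrix.diagonal D *ᵥ (V₂ᴴ *ᵥ w) - T *ᵥ x
    have h1 : (S - V₁ * T) *ᵥ x + -(V₁ *ᵥ v) = E *ᵥ w := by
      simp only [v]
      rw [Matrix.sub_mulVec, hSx, Matrix.add_mulVec, Matrix.mulVec_sub, ← Matrix.mulVec_mulVec,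
        ← Matrix.mulVec_mulVec, ← Matrix.mulVec_mulVec]
      abel
    have h2 : star ((S - V₁ * T) *ᵥ x) ⬝ᵥ -(V₁ *ᵥ v) = 0 := by
      rw [dotProduct_neg, star_dotProduct_mulVec, Matrix.mulVec_mulVec, hT]
      simp
    have h3 := l2norm_add_sq h2
    rw [h1] at h3
    refine le_of_sq_le_sq ?_ (l2norm_nonneg _)
    rw [h3]
    linarith [sq_nonneg (l2norm (-(V₁ *ᵥ v)))]
  refine hbest.trans ((hE w).trans ?_)
  calc γ * (a * m₁ * m₂) * l2norm w
      ≤ γ * (a * m₁ * m₂) * (l2norm x / ((1 - γ) * (a * m₁ * m₂))) := by gcongr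
    _ = γ / (1 - γ) * l2norm x := by
      have : 1 - γ ≠ 0 := by linarith
      field_simp

end IsSVD

end SVD

/-! ### Hankel matrices: noise bound and Vandermonde factorization -/

section Hankel

lemma l2norm_comp_le {ι κ : Type*} [Fintype ι] [Fintype κ] {g : κ → ι}
    (hg : Function.Injective g) (v : ι → ℂ) : l2norm (v ∘ g) ≤ l2norm v := by
  classical
  refine le_of_sq_le_sq ?_ (l2norm_nonneg _)
  rw [l2norm_sq, l2norm_sq]
  calc ∑ i, ‖(v ∘ g) i‖ ^ 2 = ∑ j ∈ Finset.univ.image g, ‖v j‖ ^ 2 :=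
        (Finset.sum_image (f := fun j => ‖v j‖ ^ 2) hg.injOn).symm
    _ ≤ ∑ j, ‖v j‖ ^ 2 :=
        Finset.sum_le_univ_sum_of_nonneg fun j => sq_nonneg _

lemma l2norm_mulVec_sq_le {ι κ : Type*} [Fintype ι] [Fintype κ] (A : Matrix ι κ ℂ) (x : κ → ℂ) :
    l2norm (A *ᵥ x) ^ 2 ≤ (∑ i, ∑ j, ‖A i j‖ ^ 2) * l2norm x ^ 2 := by
  rw [l2norm_sq, l2norm_sq, Finset.sum_mul]
  refine Finset.sum_le_sum fun i _ => ?_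
  have h1 : ‖(A *ᵥ x) i‖ ≤ ∑ j, ‖A i j‖ * ‖x j‖ := by
    refine (norm_sum_le _ _).trans_eq ?_
    simp
  exact (pow_le_pow_left₀ (norm_nonneg _) h1 2).trans (Finset.sum_mul_sq_le_sq_mul_sq _ _ _)

/-- Every row and every column is a window of `e`, so the squared Frobenius norm is at most `min L
M` times `‖e‖²`: sum over whichever direction has fewer lines. -/
lemma l2norm_hankel_mulVec_le {n : ℕ} (L M : ℕ) (h : L + M = n + 1) (e : Fin n → ℂ)
    (x : Fin M → ℂ) :
    l2norm (hankel L M h e *ᵥ x) ≤ √(min L M : ℕ) * l2norm e * l2norm x := by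
  refine le_of_sq_le_sq ((l2norm_mulVec_sq_le _ _).trans ?_)
    (mul_nonneg (mul_nonneg (Real.sqrt_nonneg _) (l2norm_nonneg _)) (l2norm_nonneg _))
  rw [mul_pow, mul_pow, Real.sq_sqrt (Nat.cast_nonneg _)]
  refine mul_le_mul_of_nonneg_right ?_ (sq_nonneg _)
  have hrow : ∀ i, ∑ j, ‖hankel L M h e i j‖ ^ 2 ≤ l2norm e ^ 2 := by
    intro i
    have := l2norm_comp_le (g := fun j : Fin M => (⟨(i : ℕ) + j, by omega⟩ : Fin n))
      (fun a b hab => by simpa [Fin.ext_iff] using hab) e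
    have := pow_le_pow_left₀ (l2norm_nonneg _) this 2
    rwa [l2norm_sq] at this
  have hcol : ∀ j, ∑ i, ‖hankel L M h e i j‖ ^ 2 ≤ l2norm e ^ 2 := by
    intro j
    have := l2norm_comp_le (g := fun i : Fin L => (⟨(i : ℕ) + j, by omega⟩ : Fin n))
      (fun a b hab => by simpa [Fin.ext_iff] using hab) e
    have := pow_le_pow_left₀ (l2norm_nonneg _) this 2
    rwa [l2norm_sq] at this
  rcases le_total L M with hLM | hLM
  · rw [min_eq_left hLM]
    refine (Finset.sum_le_sum fun i _ => hrow i).trans_eq ?_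
    simp
  · rw [min_eq_right hLM, Finset.sum_comm]
    refine (Finset.sum_le_sum fun i _ => hcol i).trans_eq ?_
    simp

/-- Conjugating the nodes makes the adjoint a plain transpose, which gives the shape `V₁ D V₂ᴴ` of
`IsSVD.exists_projection`. -/
lemma hankel_exponential_sum {K n : ℕ} (L M : ℕ) (h : L + M = n + 1) (z α : Fin K → ℂ) :
    hankel L M h (fun i => ∑ k, α k * z k ^ (i : ℕ)) =
      vand L z * Matrix.diagonal α * (vand M (star z))ᴴ := by
  ext i j
  rw [Matrix.mul_apply]
  simp only [hankel, Matrix.of_apply, Matrix.mul_diagonal, vand, Matrix.conjTranspose_apply]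
  refine Finset.sum_congr rfl fun k _ => ?_
  rw [pow_add, Pi.star_apply, star_pow, star_star]
  ring

lemma hankel_add {n : ℕ} (L M : ℕ) (h : L + M = n + 1) (x y : Fin n → ℂ) :
    hankel L M h (x + y) = hankel L M h x + hankel L M h y := rfl

lemma l2norm_vand_star_mulVec {K : ℕ} (M : ℕ) (z : Fin K → ℂ) (y : Fin K → ℂ) :
    l2norm (vand M (star z) *ᵥ y) = l2norm (vand M z *ᵥ star y) := by
  rw [← l2norm_star]
  congr 1
  ext i
  simp [vand, Matrix.mulVec, dotProduct]

lemma sigmaMin_vand_mul_le_star {K M : ℕ} (h : K ≤ M) (z : Fin K → ℂ) (y : Fin K → ℂ) :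
    sigmaMin (vand M z) * l2norm y ≤ l2norm (vand M (star z) *ᵥ y) := by
  rw [l2norm_vand_star_mulVec, ← l2norm_star y]
  exact sigmaMin_mul_l2norm_le h _ _

end Hankel

/-! ### Bauer–Fike with optimal matching -/

section BauerFike

variable {K : ℕ}

lemma exists_eq_map_univ {α : Type*} {s : Multiset α} (hs : s.card = K) :
    ∃ v : Fin K → α, s = Finset.univ.val.map v := by
  subst hs
  refine ⟨fun i => s.toList.get (Fin.cast (by simp) i), ?_⟩
  conv_lhs => rw [← Multiset.coe_toList s]
  rw [Fin.univ_val_map, Multiset.coe_eq_coe]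
  refine List.Perm.of_eq (List.ext_get (by simp) fun n h1 h2 => by simp)

lemma eval_charpoly_eq_prod {A : Matrix (Fin K) (Fin K) ℂ} {w : Fin K → ℂ}
    (h : IsEigenvalueList A w) (x : ℂ) : A.charpoly.eval x = ∏ i, (x - w i) := by
  rw [(IsAlgClosed.splits A.charpoly).eval_eq_prod_roots_of_monic A.charpoly_monic, h,
    Multiset.map_map]
  rfl

lemma exists_isEigenvalueList (A : Matrix (Fin K) (Fin K) ℂ) : ∃ w, IsEigenvalueList A w :=
  exists_eq_map_univ (by
    rw [← (IsAlgClosed.splits A.charpoly).natDegree_eq_card_roots, A.charpoly_natDegree_eq_dim,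
      Fintype.card_fin])

/-- A Bauer–Fike theorem with optimal matching, for a matrix `A` diagonalized by `T`. -/
theorem exists_perm_norm_sub_le {A Δ T : Matrix (Fin K) (Fin K) ℂ} {z w : Fin K → ℂ}
    (hA : T * A = Matrix.diagonal z * T) {t₁ t₂ δ : ℝ} (ht₁ : 0 < t₁) (ht₂ : 0 ≤ t₂) (hδ : 0 ≤ δ)
    (hT₁ : ∀ x, t₁ * l2norm x ≤ l2norm (T *ᵥ x)) (hT₂ : ∀ x, l2norm (T *ᵥ x) ≤ t₂ * l2norm x)
    (hΔ : ∀ x, l2norm (Δ *ᵥ x) ≤ δ * l2norm x) (hw : IsEigenvalueList (A + Δ) w) :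
    ∃ π : Equiv.Perm (Fin K), ∀ k, ‖w (π k) - z k‖ ≤ (2 * (K : ℝ) - 1) * (t₂ / t₁ * δ) := by
  have hr : 0 ≤ t₂ / t₁ * δ := by positivity
  let f : unitInterval → ℂ → ℂ := fun t x => (A + (t : ℂ) • Δ).charpoly.eval x
  have hclose : ∀ t x, f t x = 0 → ∃ k, ‖x - z k‖ ≤ t₂ / t₁ * δ := by
    intro t x hx
    simp only [f, Matrix.eval_charpoly] at hx
    obtain ⟨v, hv, hv0⟩ := Matrix.exists_mulVec_eq_zero_iff.2 hx
    rw [Matrix.sub_mulVec, Matrix.scalar_apply, sub_eq_zero] at hv0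
    -- In the coordinates `T v` the eigenvector equation says that `diag(x - z)` acts as the
    -- perturbation; comparing norms bounds the smallest `‖x - z k‖`.
    have h1 : Matrix.diagonal (fun k => x - z k) *ᵥ (T *ᵥ v) = T *ᵥ ((t : ℂ) • (Δ *ᵥ v)) := by
      have h2 : T *ᵥ (A *ᵥ v) = Matrix.diagonal z *ᵥ (T *ᵥ v) := by
        rw [Matrix.mulVec_mulVec, hA, Matrix.mulVec_mulVec]
      have h3 := congrArg (T *ᵥ ·) hv0
      simp only [Matrix.add_mulVec, Matrix.mulVec_add, h2, Matrix.smul_mulVec] at h3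
      rw [← sub_eq_iff_eq_add'] at h3
      rw [← h3]
      ext i
      have h4 : Matrix.diagonal (fun _ => x) *ᵥ v = x • v := by
        ext j; simp [Matrix.mulVec_diagonal]
      rw [h4, Matrix.mulVec_smul]
      simp only [Pi.sub_apply, Pi.smul_apply, Matrix.mulVec_diagonal, smul_eq_mul]
      ring
    by_contra! hk
    obtain ⟨c, hc, hck⟩ : ∃ c, t₂ / t₁ * δ < c ∧ ∀ k, c ≤ ‖x - z k‖ := by
      have hne : Nonempty (Fin K) := by
        by_contra hemp
        rw [not_nonempty_iff] at hemp
        exact hv (Subsingleton.elim _ _)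
      obtain ⟨k₀, hk₀⟩ := Finite.exists_min fun k => ‖x - z k‖
      exact ⟨_, hk k₀, hk₀⟩
    have h5 := le_l2norm_diagonal_mulVec (hr.trans hc.le) hck (T *ᵥ v)
    rw [h1] at h5
    have h6 := hT₂ ((t : ℂ) • (Δ *ᵥ v))
    rw [l2norm_smul] at h6
    have h7 : ‖(t : ℂ)‖ ≤ 1 := by
      rw [Complex.norm_real, Real.norm_of_nonneg t.2.1]; exact t.2.2
    have h8 : ‖(t : ℂ)‖ * l2norm (Δ *ᵥ v) ≤ δ * l2norm v :=
      (mul_le_of_le_one_left (l2norm_nonneg _) h7).trans (hΔ v)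
    have h9 := hT₁ v
    have hv' := l2norm_pos hv
    have h10 : c * (t₁ * l2norm v) ≤ t₂ * (δ * l2norm v) :=
      (mul_le_mul_of_nonneg_left h9 (hr.trans hc.le)).trans
        (h5.trans (h6.trans (mul_le_mul_of_nonneg_left h8 ht₂)))
    have h11 : t₂ / t₁ * δ * (t₁ * l2norm v) = t₂ * (δ * l2norm v) := by
      field_simp
    have h12 := mul_lt_mul_of_pos_right hc (mul_pos ht₁ hv')
    linarith
  have h0 : ∀ x, f 0 x = ∏ i, (x - z i) := by
    intro x
    have hdet : T.det ≠ 0 := by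
      intro h0
      obtain ⟨v, hv, hv0⟩ := Matrix.exists_mulVec_eq_zero_iff.2 h0
      have := hT₁ v
      rw [hv0, l2norm_zero] at this
      nlinarith [l2norm_pos hv]
    have h1 : T * (Matrix.scalar (Fin K) x - A) = Matrix.diagonal (fun k => x - z k) * T := by
      rw [Matrix.mul_sub, hA, ← (Matrix.scalar_commute x (fun _ => .all _ _) T).eq, ← Matrix.sub_mul,
        Matrix.scalar_apply, Matrix.diagonal_sub]
    have h2 := congrArg Matrix.det h1
    rw [Matrix.det_mul, Matrix.det_mul, Matrix.det_diagonal, mul_comm] at h2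
    simp only [f, Matrix.eval_charpoly]
    simpa using mul_right_cancel₀ hdet h2
  refine exists_perm_of_path (d := fun x y => ‖x - y‖) (z := z) (w := w) (f := f)
    (R := ∑ k, ‖z k‖ + t₂ / t₁ * δ) (by fun_prop) (fun x => by simp)
    (fun x y => norm_sub_rev x y) (fun x y w => norm_sub_le_norm_sub_add_norm_sub x y w)
    hr (fun x k hx => ?_) ?_ (fun t => ?_) h0 (fun x => ?_) hclose
  · have h1 : ‖x‖ ≤ ‖z k‖ + ‖x - z k‖ := by
      simpa using norm_add_le (z k) (x - z k)
    have h2 := Finset.single_le_sum (f := fun k => ‖z k‖) (fun i _ => norm_nonneg _)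
      (Finset.mem_univ k)
    linarith
  · simp only [f, Matrix.eval_charpoly]
    refine Continuous.matrix_det (Continuous.sub ?_ ?_)
    · exact continuous_matrix fun i j => by
        simp only [Matrix.scalar_apply, Matrix.diagonal_apply]
        split_ifs <;> fun_prop
    · fun_prop
  · obtain ⟨v, hv⟩ := exists_isEigenvalueList (A + (t : ℂ) • Δ)
    exact ⟨v, fun x => eval_charpoly_eq_prod hv x⟩
  · simpa [f] using eval_charpoly_eq_prod hw x

end BauerFike

/-! ### ESPRIT: shift invariance and perturbation of the rotation matrix -/

section Esprit

variable {K L : ℕ}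

lemma l2norm_rowsDown_mulVec_le (A : Matrix (Fin L) (Fin K) ℂ) (x : Fin K → ℂ) :
    l2norm (rowsDown A *ᵥ x) ≤ l2norm (A *ᵥ x) :=
  l2norm_comp_le (g := fun i : Fin (L - 1) => (⟨(i : ℕ), by omega⟩ : Fin L))
    (fun a b hab => by simpa [Fin.ext_iff] using hab) (A *ᵥ x)

lemma l2norm_rowsUp_mulVec_le (A : Matrix (Fin L) (Fin K) ℂ) (x : Fin K → ℂ) :
    l2norm (rowsUp A *ᵥ x) ≤ l2norm (A *ᵥ x) :=
  l2norm_comp_le (g := fun i : Fin (L - 1) => (⟨(i : ℕ) + 1, by omega⟩ : Fin L))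
    (fun a b hab => by simpa [Fin.ext_iff] using hab) (A *ᵥ x)

/-- Shift invariance: the reason the eigenvalues recover the nodes. -/
lemma rowsUp_vand (z : Fin K → ℂ) :
    rowsUp (vand L z) = vand (L - 1) z * Matrix.diagonal z := by
  ext i k
  rw [Matrix.mul_diagonal]
  simp [rowsUp, vand, pow_succ]

namespace IsMoorePenrose

variable {m n : ℕ} {A : Matrix (Fin m) (Fin n) ℂ} {G : Matrix (Fin n) (Fin m) ℂ}

lemma mul_eq_one (h : IsMoorePenrose A G) (hA : ∀ x, A *ᵥ x = 0 → x = 0) : G * A = 1 := by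
  refine Matrix.ext_of_mulVec_single fun i => ?_
  have h1 := hA ((G * A) *ᵥ Pi.single i 1 - Pi.single i 1) (by
    rw [Matrix.mulVec_sub, Matrix.mulVec_mulVec, ← Matrix.mul_assoc, h.mul_mul_left, sub_self])
  rw [sub_eq_zero.1 h1, Matrix.one_mulVec]

/-- `A G` is an orthogonal projection, so `c ‖G y‖ ≤ ‖A G y‖ ≤ ‖y‖`. -/
lemma mul_l2norm_le (h : IsMoorePenrose A G) {c : ℝ}
    (hA : ∀ x, c * l2norm x ≤ l2norm (A *ᵥ x)) (y : Fin m → ℂ) :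
    c * l2norm (G *ᵥ y) ≤ l2norm y := by
  refine (hA _).trans ?_
  rw [Matrix.mulVec_mulVec]
  have h1 := norm_star_dotProduct_self ((A * G) *ᵥ y)
  rw [star_dotProduct_mulVec, h.isHermitian_left.eq, Matrix.mulVec_mulVec, ← Matrix.mul_assoc,
    h.mul_mul_left] at h1
  have h2 := norm_dotProduct_le ((A * G) *ᵥ y) y
  rw [h1] at h2
  by_contra! h3
  nlinarith [l2norm_nonneg y]

end IsMoorePenrose

section Projection

variable {p : ℕ} {S V : Matrix (Fin p) (Fin K) ℂ} {T : Matrix (Fin K) (Fin K) ℂ}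

/-- Pythagoras for `S x = V T x + (S - V T) x`, where `S` is isometric. -/
lemma l2norm_projection_sq_add (hS : Sᴴ * S = 1) (horth : Vᴴ * (S - V * T) = 0) (x : Fin K → ℂ) :
    l2norm (V *ᵥ (T *ᵥ x)) ^ 2 + l2norm ((S - V * T) *ᵥ x) ^ 2 = l2norm x ^ 2 := by
  rw [← l2norm_mulVec_of_conjTranspose_mul_self hS x, ← l2norm_add_sq, Matrix.mulVec_mulVec,
    ← Matrix.add_mulVec, add_sub_cancel]
  rw [← star_star (star (V *ᵥ T *ᵥ x) ⬝ᵥ (S - V * T) *ᵥ x), ← Matrix.star_dotProduct,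
    star_dotProduct_mulVec, Matrix.mulVec_mulVec, horth]
  simp

lemma l2norm_projection_le (hS : Sᴴ * S = 1) (horth : Vᴴ * (S - V * T) = 0) (x : Fin K → ℂ) :
    l2norm (V *ᵥ (T *ᵥ x)) ≤ l2norm x := by
  refine le_of_sq_le_sq ?_ (l2norm_nonneg _)
  have := l2norm_projection_sq_add hS horth x
  linarith [sq_nonneg (l2norm ((S - V * T) *ᵥ x))]

lemma le_l2norm_projection (hS : Sᴴ * S = 1) (horth : Vᴴ * (S - V * T) = 0) {s c : ℝ}
    (hsc : s ^ 2 + c ^ 2 = 1)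
    (hsin : ∀ x, l2norm ((S - V * T) *ᵥ x) ≤ s * l2norm x) (x : Fin K → ℂ) :
    c * l2norm x ≤ l2norm (V *ᵥ (T *ᵥ x)) := by
  refine le_of_sq_le_sq ?_ (l2norm_nonneg _)
  have h1 := pow_le_pow_left₀ (l2norm_nonneg _) (hsin x) 2
  rw [mul_pow] at h1 ⊢
  have h2 : c ^ 2 = 1 - s ^ 2 := by linarith
  rw [h2]
  linarith [l2norm_projection_sq_add hS horth x]

/-- `Vᴴ S = Vᴴ V T`: one factor `c` from the projection and one factor `m` from `Vᴴ` on the range of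
`V`. It controls the outer factors of the compressed pencil. -/
lemma le_l2norm_conjTranspose_mul_mulVec (hS : Sᴴ * S = 1) (horth : Vᴴ * (S - V * T) = 0)
    {s c m : ℝ} (hsc : s ^ 2 + c ^ 2 = 1)
    (hsin : ∀ x, l2norm ((S - V * T) *ᵥ x) ≤ s * l2norm x) (hm : 0 ≤ m)
    (hV : ∀ x, m * l2norm x ≤ l2norm (V *ᵥ x)) (x : Fin K → ℂ) :
    m * c * l2norm x ≤ l2norm ((Vᴴ * S) *ᵥ x) := by
  have h1 : Vᴴ * S = Vᴴ * (V * T) := by rwa [Matrix.mul_sub, sub_eq_zero] at horth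
  rw [h1, ← Matrix.mulVec_mulVec, ← Matrix.mulVec_mulVec, mul_assoc]
  exact (mul_le_mul_of_nonneg_left (le_l2norm_projection hS horth hsc hsin x) hm).trans
    (le_l2norm_conjTranspose_mulVec_mulVec hV _)

end Projection

/-- The eigenvalues of `S↓† S↑` are close to the nodes `z` if `S` is close to an orthogonal
projection `V T` of `S` onto the range of the Vandermonde matrix `V`. -/
theorem exists_perm_esprit {z w : Fin K → ℂ} (hz1 : ∀ k, ‖z k‖ ≤ 1)
    {S : Matrix (Fin L) (Fin K) ℂ} {T : Matrix (Fin K) (Fin K) ℂ} {G : Matrix (Fin K) (Fin (L - 1)) ℂ}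
    (hS : Sᴴ * S = 1) (horth : (vand L z)ᴴ * (S - vand L z * T) = 0) {s c m m' M : ℝ}
    (hs0 : 0 ≤ s) (hc : 0 < c) (hsc : s ^ 2 + c ^ 2 = 1) (hm : 0 < m) (hm' : 0 < m') (hM : 0 < M)
    (hsin : ∀ x, l2norm ((S - vand L z * T) *ᵥ x) ≤ s * l2norm x)
    (hVm : ∀ x, m * l2norm x ≤ l2norm (vand L z *ᵥ x))
    (hVm' : ∀ x, m' * l2norm x ≤ l2norm (vand (L - 1) z *ᵥ x))
    (hVM : ∀ x, l2norm (vand L z *ᵥ x) ≤ M * l2norm x)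
    (hsep : s < c * m' / M) (hG : IsMoorePenrose (rowsDown S) G)
    (hw : IsEigenvalueList (G * rowsUp S) w) :
    ∃ π : Equiv.Perm (Fin K), ∀ k, ‖w (π k) - z k‖ ≤ (2 * (K : ℝ) - 1) *
      ((1 / m) / (c / M) * (s * (1 + M / (c * m)) / (c * m' / M - s))) := by
  set V := vand L z with hV
  set R := S - V * T with hR
  have hSR : S = V * T + R := by rw [hR]; abel
  have hVT_le := l2norm_projection_le hS horth
  have hle_VT := le_l2norm_projection hS horth hsc hsin
  have hT₁ : ∀ x, c / M * l2norm x ≤ l2norm (T *ᵥ x) := by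
    intro x
    have := (hle_VT x).trans (hVM (T *ᵥ x))
    rw [div_mul_eq_mul_div, div_le_iff₀ hM]
    linarith
  have hT₂ : ∀ x, l2norm (T *ᵥ x) ≤ 1 / m * l2norm x := by
    intro x
    have := (hVm (T *ᵥ x)).trans (hVT_le x)
    rw [div_mul_eq_mul_div, le_div_iff₀ hm]
    linarith
  have hcM : 0 < c / M := div_pos hc hM
  have hdet : T.det ≠ 0 := by
    intro h0
    obtain ⟨v, hv, hv0⟩ := Matrix.exists_mulVec_eq_zero_iff.2 h0
    have := hT₁ v
    rw [hv0, l2norm_zero] at this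
    nlinarith [l2norm_pos hv]
  let A := T⁻¹ * (Matrix.diagonal z * T)
  have hA : T * A = Matrix.diagonal z * T := Matrix.mul_nonsing_inv_cancel_left _ _ (Ne.isUnit hdet)
  have hAle : ∀ x, l2norm (A *ᵥ x) ≤ M / (c * m) * l2norm x := by
    intro x
    have h0 : T *ᵥ (A *ᵥ x) = Matrix.diagonal z *ᵥ (T *ᵥ x) := by
      rw [Matrix.mulVec_mulVec, hA, Matrix.mulVec_mulVec]
    have h1 := hT₁ (A *ᵥ x)
    rw [h0] at h1
    have h2 := l2norm_diagonal_mulVec_le zero_le_one hz1 (T *ᵥ x)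
    have h3 := hT₂ x
    have h4 : c / M * l2norm (A *ᵥ x) ≤ 1 / m * l2norm x := by linarith
    calc l2norm (A *ᵥ x) = M / c * (c / M * l2norm (A *ᵥ x)) := by field_simp
      _ ≤ M / c * (1 / m * l2norm x) := by gcongr
      _ = _ := by field_simp
  have hdown : rowsDown S = vand (L - 1) z * T + rowsDown R := by
    conv_lhs => rw [hSR]
    rfl
  have hup : rowsUp S = vand (L - 1) z * Matrix.diagonal z * T + rowsUp R := by
    rw [← rowsUp_vand]
    conv_lhs => rw [hSR]
    rfl
  -- `V↓ T` is bounded below by `m' · c / M`, and `R↓` costs at most `s`; `hsep` makes the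
  -- difference positive.
  have hSdown : ∀ x, (c * m' / M - s) * l2norm x ≤ l2norm (rowsDown S *ᵥ x) := by
    intro x
    have h1 := l2norm_sub_l2norm_le (vand (L - 1) z *ᵥ (T *ᵥ x)) (-(rowsDown R *ᵥ x))
    rw [sub_neg_eq_add, Matrix.mulVec_mulVec, ← Matrix.add_mulVec, ← hdown,
      ← Matrix.mulVec_mulVec] at h1
    have h2 := (l2norm_rowsDown_mulVec_le R x).trans (hsin x)
    have h3 := hVm' (T *ᵥ x)
    have h4 := mul_le_mul_of_nonneg_left (hT₁ x) hm'.le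
    have h5 : l2norm (-(rowsDown R *ᵥ x)) = l2norm (rowsDown R *ᵥ x) := by simp [l2norm]
    rw [h5] at h1
    have h6 : m' * (c / M * l2norm x) = c * m' / M * l2norm x := by ring
    linarith
  have hpos : 0 < c * m' / M - s := by linarith
  have hGS : G * rowsDown S = 1 := by
    refine hG.mul_eq_one fun x hx => ?_
    have := hSdown x
    rw [hx, l2norm_zero] at this
    exact l2norm_eq_zero.1 (le_antisymm (by nlinarith [l2norm_nonneg x]) (l2norm_nonneg x))
  refine exists_perm_norm_sub_le (A := A) (Δ := G * (rowsUp R - rowsDown R * A)) (T := T) hA hcM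
    (by positivity) (div_nonneg (by positivity) hpos.le) hT₁ hT₂ (fun x => ?_) ?_
  · rw [← Matrix.mulVec_mulVec, div_mul_eq_mul_div, le_div_iff₀ hpos, mul_comm]
    refine (hG.mul_l2norm_le hSdown _).trans ?_
    rw [Matrix.sub_mulVec, ← Matrix.mulVec_mulVec]
    have h1 := l2norm_sub_le (rowsUp R *ᵥ x) (rowsDown R *ᵥ (A *ᵥ x))
    have h2 := (l2norm_rowsUp_mulVec_le R x).trans (hsin x)
    have h3 := (l2norm_rowsDown_mulVec_le R (A *ᵥ x)).trans (hsin (A *ᵥ x))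
    have h4 := mul_le_mul_of_nonneg_left (hAle x) hs0
    linarith
  -- The signal parts cancel because `V↑ T = V↓ diag(z) T = V↓ T A`; then `G S↓ = 1` leaves `G S↑ -
  -- A`.
  · have h1 : rowsUp R - rowsDown R * A = rowsUp S - rowsDown S * A := by
      rw [hup, hdown, Matrix.add_mul, Matrix.mul_assoc _ T A, hA, Matrix.mul_assoc]
      abel
    rw [h1, Matrix.mul_sub, ← Matrix.mul_assoc, hGS, Matrix.one_mul]
    simpa using hw

/-- In terms of `s` the hypothesis reads `√2 β s < 1`, and the fraction on the right is `√2 β s / (1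
- √2 β s)`. After `c + κ ≤ 1 + κ`, what remains is `1 - √2 β s ≤ √2 c² (c - β s)`, which for `β ≥ 1`
follows from `√2 (c³ + s³) ≥ 1`. -/
lemma esprit_bound_le {β γ κ s c : ℝ} (hβ : 1 ≤ β) (hγ0 : 0 ≤ γ) (hκ : 0 < κ)
    (hγ : γ < 1 / (1 + √2 * β)) (hs : s = γ / (1 - γ)) (hc : 0 < c) (hsc : s ^ 2 + c ^ 2 = 1) :
    β * s < c ∧ κ / c * (s * (1 + κ / c) / (c / β - s)) ≤
      √2 * β * γ / (1 - (1 + √2 * β) * γ) * ((1 + κ) * κ) := by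
  set q := √2 with hq
  have hq2 : q ^ 2 = 2 := Real.sq_sqrt (by norm_num)
  have hq0 : 0 < q := Real.sqrt_pos.2 (by norm_num)
  have hqβ : 0 < q * β := by positivity
  rw [lt_div_iff₀ (by positivity)] at hγ
  have hγ1 : 0 < 1 - γ := by nlinarith
  have hs0 : 0 ≤ s := hs ▸ div_nonneg hγ0 hγ1.le
  have hγs : γ = s * (1 - γ) := by rw [hs]; field_simp
  have hβs : q * β * s < 1 := by
    rw [hs, ← mul_div_assoc, div_lt_one hγ1]
    linarith
  have hqs : q * s < 1 := by nlinarith [mul_nonneg hq0.le hs0]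
  have hqc : 1 < q * c := by
    by_contra! h
    have h1 : (q * s) ^ 2 < 1 := by nlinarith [mul_nonneg hq0.le hs0]
    have h2 : (q * c) ^ 2 ≤ 1 := by nlinarith [mul_pos hq0 hc]
    nlinarith
  have hlt : β * s < c := by nlinarith
  refine ⟨hlt, ?_⟩
  have hcubes : 1 ≤ q * (c ^ 3 + s ^ 3) := by
    have h1 : (c + s) ^ 2 ≤ 2 := by nlinarith [sq_nonneg (c - s)]
    have h2 : c + s ≤ q := by
      refine le_of_sq_le_sq (by linarith) hq0.le
    -- Cauchy–Schwarz in explicit form; together with `c + s ≤ √2` it gives the claim.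
    have h3 : 1 ≤ (c + s) * (c ^ 3 + s ^ 3) := by
      have : (c + s) * (c ^ 3 + s ^ 3) = (s ^ 2 + c ^ 2) ^ 2 + c * s * (c - s) ^ 2 := by ring
      rw [this, hsc]
      have := mul_nonneg (mul_nonneg hc.le hs0) (sq_nonneg (c - s))
      linarith
    have h4 : 0 ≤ c ^ 3 + s ^ 3 := by positivity
    nlinarith
  have hmain : 1 - q * β * s ≤ q * c ^ 2 * (c - β * s) := by
    have h1 : q * c ^ 2 * (c - β * s) - (1 - q * β * s) =
        q * (c ^ 3 + s ^ 3) - 1 + q * (β - 1) * s ^ 3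
          + q * β * s * (1 - (s ^ 2 + c ^ 2)) := by ring
    rw [hsc] at h1
    have h2 : 0 ≤ q * (β - 1) * s ^ 3 :=
      mul_nonneg (mul_nonneg hq0.le (by linarith)) (by positivity)
    linarith
  have hc1 : c ≤ 1 := by nlinarith
  have hden : 0 < c - β * s := by linarith
  have hden' : 0 < 1 - q * β * s := by linarith
  have hrhs : q * β * γ / (1 - (1 + q * β) * γ) = q * β * s / (1 - q * β * s) := by
    rw [div_eq_div_iff (by nlinarith) hden'.ne']
    rw [hs]
    field_simp
    ring
  have hlhs : κ / c * (s * (1 + κ / c) / (c / β - s)) =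
      κ * (c + κ) * (β * s / (c ^ 2 * (c - β * s))) := by
    have h1 : c / β - s ≠ 0 := by
      have : c / β - s = (c - β * s) / β := by field_simp
      rw [this]; positivity
    field_simp
  rw [hrhs, hlhs]
  have h5 : β * s / (c ^ 2 * (c - β * s)) ≤ q * β * s / (1 - q * β * s) := by
    rw [div_le_div_iff₀ (by positivity) hden']
    have := mul_le_mul_of_nonneg_left hmain (by positivity : 0 ≤ β * s)
    linarith
  calc κ * (c + κ) * (β * s / (c ^ 2 * (c - β * s)))
      ≤ κ * (1 + κ) * (q * β * s / (1 - q * β * s)) := by gcongr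
    _ = _ := by ring

end Esprit

/-! ### The ESPRIT bound -/

section EspritMain

variable {K N : ℕ}

lemma measurements_eq (z α : Fin K → ℂ) (e : EuclideanSpace ℂ (Fin N)) :
    measurements z α e = (fun i : Fin N => ∑ k, α k * z k ^ (i : ℕ)) + e.ofLp := rfl

/-- The separate bound `b` admits noise shortened by one sample, as in the matrix pencil method. -/
lemma l2norm_hankel_noise_le {L M n : ℕ} (h : L + M = n + 1) {e : Fin n → ℂ} {b γ σ : ℝ}
    (hσ : 0 < σ) (he : l2norm e ≤ b) (hγ : γ = √(min L M : ℕ) * b / σ) (x : Fin M → ℂ) :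
    l2norm (hankel L M h e *ᵥ x) ≤ γ * σ * l2norm x := by
  refine (l2norm_hankel_mulVec_le L M h e x).trans ?_
  rw [hγ, div_mul_cancel₀ _ hσ.ne']
  gcongr
  exact l2norm_nonneg x

theorem esprit_main {L : ℕ} (hK : 0 < K) (hKL : K ≤ L) (hLN : L + K ≤ N) {z : Fin K → ℂ}
    (hz : Function.Injective z) (hz1 : ∀ k, ‖z k‖ ≤ 1) {α : Fin K → ℂ}
    (e : EuclideanSpace ℂ (Fin N)) {a : ℝ} (ha : 0 < a) (haα : ∀ k, a ≤ ‖α k‖) (hL : K + 1 ≤ L)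
    {β γ : ℝ} (hβ : β = sigmaMax (vand L z) / sigmaMin (vand (L - 1) z))
    (hγ : γ = √(min L (N - L + 1) : ℕ) * ‖e‖ /
      (a * sigmaMin (vand L z) * sigmaMin (vand (N - L + 1) z)))
    (hγ1 : γ < 1 / (1 + √2 * β)) {w : Fin K → ℂ}
    (hw : IsEsprit K L hKL hLN (measurements z α e) w) :
    ∃ π : Equiv.Perm (Fin K), ∀ k, ‖w (π k) - z k‖ ≤
      (2 * (K : ℝ) - 1) * √2 * β * γ / (1 - (1 + √2 * β) * γ) *
        ((1 + kappa (vand L z)) * kappa (vand L z)) := by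
  obtain ⟨U, s, W, G, hsvd, hG, hw⟩ := hw
  have hm := sigmaMin_vand_pos hK hKL hz
  have hm' := sigmaMin_vand_pos hK (by omega : K ≤ L - 1) hz
  have hm₂ := sigmaMin_vand_pos hK (by omega : K ≤ N - L + 1) hz
  have hVm := sigmaMin_mul_l2norm_le hKL (vand L z)
  have hVm' := sigmaMin_mul_l2norm_le (by omega : K ≤ L - 1) (vand (L - 1) z)
  have hVM := l2norm_mulVec_le_sigmaMax (vand L z)
  have hVm₂ := sigmaMin_vand_mul_le_star (by omega : K ≤ N - L + 1) z
  have hM : 0 < sigmaMax (vand L z) := hm.trans_le (sigmaMin_le_sigmaMax _)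
  unfold kappa
  set m := sigmaMin (vand L z)
  set m' := sigmaMin (vand (L - 1) z)
  set m₂ := sigmaMin (vand (N - L + 1) z)
  set M := sigmaMax (vand L z)
  -- `V_{L-1}` is `V_L` without its last row; test both on a unit vector.
  have hβ1 : 1 ≤ β := by
    rw [hβ, one_le_div hm']
    let x : Fin K → ℂ := Pi.single ⟨0, hK⟩ 1
    have hx : 0 < l2norm x := l2norm_pos fun h => by
      simpa [x] using congrFun h ⟨0, hK⟩
    have h1 := ((hVm' x).trans (l2norm_rowsDown_mulVec_le (vand L z) x)).trans (hVM x)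
    exact le_of_mul_le_mul_right h1 hx
  have hσ : 0 < a * m * m₂ := by positivity
  have hγ0 : 0 ≤ γ := by rw [hγ]; positivity
  have hγlt : γ < 1 := hγ1.trans_le (by
    rw [div_le_one (by positivity)]
    have : 0 ≤ √2 * β := by positivity
    linarith)
  rw [measurements_eq, hankel_add, hankel_exponential_sum] at hsvd
  obtain ⟨T, horth, hsin⟩ := hsvd.exists_projection hKL (by omega) hm hm₂ ha hVm hVm₂ haα hγ0 hγlt
    (l2norm_hankel_noise_le _ hσ le_rfl hγ)
  have hκ : 0 < M / m := div_pos hM hm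
  have hq1 : 1 ≤ √2 := Real.one_le_sqrt.2 (by norm_num)
  have hs1 : γ / (1 - γ) < 1 := by
    rw [div_lt_one (by linarith)]
    rw [lt_div_iff₀ (by positivity)] at hγ1
    nlinarith [mul_le_mul hq1 hβ1 zero_le_one (by linarith)]
  have hs0 : 0 ≤ γ / (1 - γ) := div_nonneg hγ0 (by linarith)
  have hc2 : 0 < 1 - (γ / (1 - γ)) ^ 2 := by nlinarith
  have hc := Real.sqrt_pos.2 hc2
  have hsc : (γ / (1 - γ)) ^ 2 + √(1 - (γ / (1 - γ)) ^ 2) ^ 2 = 1 := by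
    rw [Real.sq_sqrt hc2.le]; ring
  obtain ⟨hlt, hbound⟩ := esprit_bound_le hβ1 hγ0 hκ hγ1 rfl hc hsc
  set c := √(1 - (γ / (1 - γ)) ^ 2)
  set t := γ / (1 - γ)
  have hcβ : c * m' / M = c / β := by rw [hβ]; field_simp
  obtain ⟨π, hπ⟩ := exists_perm_esprit hz1 (firstCols_conjTranspose_mul_self hKL hsvd.unitary_left)
    horth hs0 hc hsc hm hm' hM hsin hVm hVm' hVM
    (by rw [hcβ, lt_div_iff₀ (by linarith)]; linarith) hG hw
  refine ⟨π, fun k => (hπ k).trans ?_⟩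
  have hK1 : (1 : ℝ) ≤ K := by exact_mod_cast hK
  have h1 : (1 / m) / (c / M) * (t * (1 + M / (c * m)) / (c * m' / M - t)) =
      M / m / c * (t * (1 + M / m / c) / (c / β - t)) := by
    rw [hcβ]
    congr 1
    · field_simp
    · rw [div_div M, mul_comm c m]
  rw [h1]
  calc _ ≤ _ := mul_le_mul_of_nonneg_left hbound (by linarith)
    _ = _ := by ring

end EspritMain

/-! ### Chordal geometry of the projective line -/

section ProjectiveLine

/-- The determinant of two vectors of the plane. -/
def cross (p q : Fin 2 → ℂ) : ℂ := p 0 * q 1 - p 1 * q 0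

/-- The chordal distance of the points of the projective line with homogeneous coordinates
`p` and `q`. -/
noncomputable def projDist (p q : Fin 2 → ℂ) : ℝ := ‖cross p q‖ / (l2norm p * l2norm q)

/-- Homogeneous coordinates of a point of the extended complex plane. -/
def homogeneous : OnePoint ℂ → Fin 2 → ℂ
  | OnePoint.some z => ![z, 1]
  | ∞ => ![1, 0]

/-- A vector orthogonal to `p` of the same length. -/
def perp (p : Fin 2 → ℂ) : Fin 2 → ℂ := ![-star (p 1), star (p 0)]

lemma l2norm_fin_two (p : Fin 2 → ℂ) : l2norm p = √(‖p 0‖ ^ 2 + ‖p 1‖ ^ 2) := by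
  rw [← Fin.sum_univ_two (fun i => ‖p i‖ ^ 2), ← l2norm_sq, Real.sqrt_sq (l2norm_nonneg p)]

lemma l2norm_perp (p : Fin 2 → ℂ) : l2norm (perp p) = l2norm p := by
  rw [l2norm_fin_two, l2norm_fin_two]
  simp [perp, add_comm]

lemma cross_perp_self (p : Fin 2 → ℂ) : cross (perp p) p = ((-l2norm p ^ 2 : ℝ) : ℂ) := by
  rw [l2norm_sq, Fin.sum_univ_two]
  simp only [cross, perp, Matrix.cons_val_zero, Matrix.cons_val_one]
  have h0 := Complex.conj_mul' (p 0)
  have h1 := Complex.conj_mul' (p 1)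
  simp only [← starRingEnd_apply]
  push_cast
  rw [← h0, ← h1]
  ring

lemma cross_self (p : Fin 2 → ℂ) : cross p p = 0 := by simp only [cross]; ring

lemma cross_comm (p q : Fin 2 → ℂ) : cross p q = -cross q p := by simp only [cross]; ring

lemma cross_add_smul (p q r : Fin 2 → ℂ) (c : ℂ) :
    cross (p + c • q) r = cross p r + c * cross q r := by
  simp [cross]; ring

lemma cross_smul_left (c : ℂ) (p q : Fin 2 → ℂ) : cross (c • p) q = c * cross p q := by
  simp [cross]; ring

/-- The Plücker relation. -/
lemma cross_smul_sub_cross_smul (p q r : Fin 2 → ℂ) :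
    cross p q • r = cross p r • q - cross q r • p := by
  ext i
  fin_cases i <;> simp [cross] <;> ring

/-- The determinant is the inner product of `perp p` with `q`. -/
lemma norm_cross_le (p q : Fin 2 → ℂ) : ‖cross p q‖ ≤ l2norm p * l2norm q := by
  rw [← l2norm_perp p]
  convert norm_dotProduct_le (perp p) q using 2
  simp [cross, perp, dotProduct]
  ring

lemma projDist_le_one (p q : Fin 2 → ℂ) : projDist p q ≤ 1 :=
  div_le_one_of_le₀ (norm_cross_le p q) (mul_nonneg (l2norm_nonneg _) (l2norm_nonneg _))

lemma projDist_self (p : Fin 2 → ℂ) : projDist p p = 0 := by simp [projDist, cross_self]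

lemma projDist_comm (p q : Fin 2 → ℂ) : projDist p q = projDist q p := by
  rw [projDist, projDist, cross_comm, norm_neg, mul_comm]

/-- Take norms in the Plücker relation and divide by the three lengths. -/
lemma projDist_triangle {p q r : Fin 2 → ℂ} (hp : p ≠ 0) (hq : q ≠ 0) (hr : r ≠ 0) :
    projDist p r ≤ projDist p q + projDist q r := by
  have h0 := l2norm_pos hp
  have h1 := l2norm_pos hq
  have h2 := l2norm_pos hr
  have h3 : ‖cross p r‖ * l2norm q ≤ ‖cross p q‖ * l2norm r + ‖cross q r‖ * l2norm p := by
    rw [← l2norm_smul, ← l2norm_smul, ← l2norm_smul]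
    have : cross p r • q = cross p q • r + cross q r • p := by
      rw [cross_smul_sub_cross_smul p q r]; abel
    rw [this]
    exact l2norm_add_le _ _
  rw [projDist, projDist, projDist, div_add_div _ _ (by positivity) (by positivity),
    div_le_div_iff₀ (by positivity) (by positivity)]
  have := mul_le_mul_of_nonneg_right h3 (by positivity : 0 ≤ l2norm p * l2norm q * l2norm r)
  linarith

lemma projDist_smul_left {c : ℂ} (hc : c ≠ 0) (p q : Fin 2 → ℂ) :
    projDist (c • p) q = projDist p q := by
  rw [projDist, projDist, cross_smul_left, l2norm_smul, norm_mul, mul_assoc,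
    mul_div_mul_left _ _ (norm_ne_zero_iff.2 hc)]

lemma projDist_smul_right {c : ℂ} (hc : c ≠ 0) (p q : Fin 2 → ℂ) :
    projDist p (c • q) = projDist p q := by
  rw [projDist_comm, projDist_smul_left hc, projDist_comm]

lemma homogeneous_ne_zero (w : OnePoint ℂ) : homogeneous w ≠ 0 := by
  induction w using OnePoint.rec with
  | infty => exact fun h => one_ne_zero (congrFun h 0)
  | coe z => exact fun h => one_ne_zero (congrFun h 1)

lemma chordal_eq_projDist (w : OnePoint ℂ) (z : ℂ) :
    chordal w z = projDist (homogeneous w) (homogeneous z) := by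
  induction w using OnePoint.rec with
  | infty =>
    change 1 / √(1 + ‖z‖ ^ 2) = _
    simp [projDist, homogeneous, cross, l2norm_fin_two, add_comm]
  | coe w =>
    change ‖w - z‖ / (√(1 + ‖w‖ ^ 2) * √(1 + ‖z‖ ^ 2)) = _
    simp [projDist, homogeneous, cross, l2norm_fin_two, add_comm]

/-- Take `K` levels in `(r, 1]` more than `2 r` apart. If each were within `r` of some `g k`, the
choice of `k` would be injective, hence surjective; but `g k₀ = 0` is within `r` of no level. -/
lemma exists_forall_lt_abs_sub {K : ℕ} {g : Fin K → ℝ} {k₀ : Fin K} (h0 : g k₀ = 0) {r : ℝ}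
    (hr : 0 ≤ r) (hKr : (2 * (K : ℝ) - 1) * r < 1) :
    ∃ τ, 0 ≤ τ ∧ τ ≤ 1 ∧ ∀ k, r < |τ - g k| := by
  have hK : (0 : ℝ) < K := by exact_mod_cast k₀.pos
  -- Chosen so that the last level is exactly `1`.
  set η := (1 - (2 * (K : ℝ) - 1) * r) / K with hη
  have hη0 : 0 < η := div_pos (by linarith) hK
  have hηK : K * η = 1 - (2 * (K : ℝ) - 1) * r := by rw [hη]; field_simp
  let τ : Fin K → ℝ := fun j => r + η + j * (2 * r + η)
  by_contra! hcon
  have hτ0 : ∀ j, r + η ≤ τ j := fun j => by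
    have : 0 ≤ (j : ℝ) * (2 * r + η) := by positivity
    simp only [τ]; linarith
  have hτ1 : ∀ j, τ j ≤ 1 := fun j => by
    have h1 : (j : ℝ) ≤ K - 1 := by
      have : ((j : ℕ) + 1 : ℝ) ≤ K := by exact_mod_cast j.2
      linarith
    have := mul_le_mul_of_nonneg_right h1 (by positivity : 0 ≤ 2 * r + η)
    simp only [τ]; nlinarith
  choose κ hκ using fun j => hcon (τ j) (by linarith [hτ0 j]) (hτ1 j)
  have hinj : Function.Injective κ := by
    intro i j hij
    by_contra hne
    have h1 := hκ i
    have h2 := hκ j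
    rw [hij] at h1
    have h3 : |τ i - τ j| ≤ 2 * r := by
      have := abs_sub_le (τ i) (g (κ j)) (τ j)
      rw [abs_sub_comm (g (κ j))] at this
      linarith
    have h4 : τ i - τ j = ((i : ℝ) - j) * (2 * r + η) := by simp only [τ]; ring
    have h5 : (1 : ℝ) ≤ |(i : ℝ) - j| := by
      have : (1 : ℤ) ≤ |(i : ℤ) - j| := Int.one_le_abs (sub_ne_zero.2 (by
        exact_mod_cast fun h => hne (Fin.ext h)))
      exact_mod_cast this
    rw [h4, abs_mul, abs_of_pos (by positivity : 0 < 2 * r + η)] at h3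
    nlinarith
  obtain ⟨j, hj⟩ := (Finite.injective_iff_surjective.1 hinj) k₀
  have h1 := hκ j
  rw [hj, h0, sub_zero] at h1
  linarith [le_abs_self (τ j), hτ0 j]

/-- `K` balls of chordal radius `r < 1 / (2 K - 1)` do not cover the projective line. -/
lemma exists_forall_lt_projDist {K : ℕ} (hK : 0 < K) {Z : Fin K → Fin 2 → ℂ} (hZ : ∀ k, Z k ≠ 0)
    {r : ℝ} (hr : 0 ≤ r) (hKr : (2 * (K : ℝ) - 1) * r < 1) :
    ∃ p, p ≠ 0 ∧ ∀ k, r < projDist p (Z k) := by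
  let k₀ : Fin K := ⟨0, hK⟩
  set u := Z k₀ with hu
  have hu0 := l2norm_pos (hZ k₀)
  obtain ⟨τ, hτ0, hτ1, hτ⟩ := exists_forall_lt_abs_sub (g := fun k => projDist u (Z k)) (k₀ := k₀)
    (projDist_self _) hr hKr
  let c := √(1 - τ ^ 2)
  have hc : c ^ 2 = 1 - τ ^ 2 := Real.sq_sqrt (by nlinarith)
  -- A point at chordal distance exactly `τ` from `u`; the triangle inequality then keeps it at
  -- least `|τ - g k|` away from `Z k`.
  let p : Fin 2 → ℂ := (c : ℂ) • u + (τ : ℂ) • perp u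
  have hp : l2norm p = l2norm u := by
    have h1 : star ((c : ℂ) • u) ⬝ᵥ ((τ : ℂ) • perp u) = 0 := by
      simp [dotProduct, perp, Fin.sum_univ_two]; ring
    have h2 := l2norm_add_sq h1
    rw [l2norm_smul, l2norm_smul, l2norm_perp, mul_pow, mul_pow, Complex.norm_real,
      Complex.norm_real, Real.norm_eq_abs, Real.norm_eq_abs, sq_abs, sq_abs, hc] at h2
    refine (pow_left_inj₀ (l2norm_nonneg _) (l2norm_nonneg _) two_ne_zero).1 (h2.trans ?_)
    ring
  have hp0 : p ≠ 0 := fun h => by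
    rw [h, l2norm_zero] at hp
    exact hu0.ne hp
  have hpu : projDist p u = τ := by
    rw [projDist, hp, cross_add_smul, cross_smul_left, cross_self, mul_zero, zero_add,
      cross_perp_self, norm_mul, Complex.norm_real, Complex.norm_real, Real.norm_of_nonneg hτ0,
      norm_neg, Real.norm_of_nonneg (sq_nonneg _)]
    have := hu0.ne'
    rw [← hu] at this
    field_simp
  refine ⟨p, hp0, fun k => (hτ k).trans_le ?_⟩
  rw [abs_le]
  have h1 := projDist_triangle (hZ k₀) hp0 (hZ k)
  have h2 := projDist_triangle hp0 (hZ k) (hZ k₀)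
  rw [← hu, projDist_comm u p, hpu] at h1
  rw [← hu, projDist_comm (Z k) u, hpu] at h2
  constructor <;> linarith

end ProjectiveLine

/-! ### Matching generalized eigenvalues of pencils -/

section Pencil

variable {K : ℕ}

/-- A continuous path of matrix pencils whose eigenvalues stay within chordal distance `r` of the
eigenvalues `Z` of the first one. -/
theorem exists_perm_projDist_le (hK : 0 < K) {A B : unitInterval → Matrix (Fin K) (Fin K) ℂ}
    (hA : Continuous A) (hB : Continuous B) {Z Y : Fin K → Fin 2 → ℂ} (hZ : ∀ k, Z k ≠ 0)
    {r : ℝ} (hr : 0 ≤ r) (hKr : (2 * (K : ℝ) - 1) * r < 1)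
    (hclose : ∀ t x, x ≠ 0 → (x 0 • A t - x 1 • B t).det = 0 → ∃ k, projDist x (Z k) ≤ r)
    {c₀ c₁ : ℂ} (h0 : ∀ x : Fin 2 → ℂ, (x 0 • A 0 - x 1 • B 0).det = c₀ * ∏ i, cross x (Z i))
    (h1 : ∀ x : Fin 2 → ℂ, (x 0 • A 1 - x 1 • B 1).det = c₁ * ∏ i, cross x (Y i)) :
    ∃ π : Equiv.Perm (Fin K), ∀ k, projDist (Y (π k)) (Z k) ≤ (2 * (K : ℝ) - 1) * r := by
  obtain ⟨p, hp, hpr⟩ := exists_forall_lt_projDist hK hZ hr hKr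
  set q := perp p
  have hp0 := l2norm_pos hp
  have hpq : cross p q ≠ 0 := by
    rw [cross_comm, cross_perp_self, neg_ne_zero, Complex.ofReal_ne_zero]
    exact (neg_neg_of_pos (by positivity)).ne
  let P : unitInterval → (Fin 2 → ℂ) → ℂ := fun t x => (x 0 • A t - x 1 • B t).det
  have hP : ∀ t, P t p ≠ 0 := by
    intro t ht
    obtain ⟨k, hk⟩ := hclose t p hp ht
    exact (hpr k).not_ge hk
  -- An affine chart with `p` at infinity. As `p` is never an eigenvalue on the path, `f t` is monic
  -- of degree `K`.
  let v : ℂ → Fin 2 → ℂ := fun τ => q + τ • p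
  have hv : ∀ τ, v τ ≠ 0 := by
    intro τ h
    have h2 : cross p (v τ) = cross p q := by simp only [v, cross]; simp; ring
    rw [h] at h2
    exact hpq (by rw [← h2]; simp [cross])
  have hvc : Continuous v := by fun_prop
  have hl2 : Continuous fun x : Fin 2 → ℂ => l2norm x := by
    simp only [l2norm_fin_two]; fun_prop
  let f : unitInterval → ℂ → ℂ := fun t τ => P t (v τ) / P t p
  let coord : (Fin 2 → ℂ) → ℂ := fun y => -cross q y / cross p y
  have hcoord : ∀ y, cross p y ≠ 0 → v (coord y) = (cross p q / cross p y) • y := by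
    intro y hy
    have h2 := cross_smul_sub_cross_smul p q y
    rw [div_eq_inv_mul, mul_smul, h2, smul_sub, smul_smul, smul_smul, inv_mul_cancel₀ hy, one_smul]
    simp only [v, coord]
    rw [div_eq_inv_mul, mul_neg, neg_smul, sub_eq_add_neg]
  have hfactor : ∀ (t : unitInterval) (c : ℂ) (y : Fin K → Fin 2 → ℂ),
      (∀ x : Fin 2 → ℂ, P t x = c * ∏ i, cross x (y i)) →
      (∀ i, cross p (y i) ≠ 0) ∧ ∀ τ, f t τ = ∏ i, (τ - coord (y i)) := by
    intro t c y h
    have h2 := hP t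
    rw [h] at h2
    have hc : c ≠ 0 := left_ne_zero_of_mul h2
    have hy : ∀ i, cross p (y i) ≠ 0 := fun i =>
      Finset.prod_ne_zero_iff.1 (right_ne_zero_of_mul h2) i (Finset.mem_univ i)
    refine ⟨hy, fun τ => ?_⟩
    simp only [f]
    rw [h, h, mul_div_mul_left _ _ hc, ← Finset.prod_div_distrib]
    refine Finset.prod_congr rfl fun i _ => ?_
    simp only [v, coord, cross_add_smul]
    have := hy i
    field_simp
    ring
  obtain ⟨hZp, hf0⟩ := hfactor 0 c₀ Z h0
  obtain ⟨hYp, hf1⟩ := hfactor 1 c₁ Y h1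
  have hvZ : ∀ x k, projDist x (v (coord (Z k))) = projDist x (Z k) := fun x k => by
    rw [hcoord _ (hZp k), projDist_smul_right (div_ne_zero hpq (hZp k))]
  have hclose' : ∀ t τ, f t τ = 0 → ∃ k, projDist (v τ) (v (coord (Z k))) ≤ r := by
    intro t τ h
    obtain ⟨k, hk⟩ := hclose t (v τ) (hv τ) ((div_eq_zero_iff.1 h).resolve_right (hP t))
    exact ⟨k, by rwa [hvZ]⟩
  -- Points in the balls keep a distance `ε` from `p`, while `cross p (v τ)` does not depend on `τ`;
  -- this bounds `‖v τ‖`.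
  have hbdd : ∃ R, ∀ τ k, projDist (v τ) (v (coord (Z k))) ≤ r → ‖τ‖ ≤ R := by
    have hne : Nonempty (Fin K) := ⟨⟨0, hK⟩⟩
    obtain ⟨k₀, hk₀⟩ := Finite.exists_min fun k => projDist p (Z k)
    set ε := projDist p (Z k₀) - r
    have hε : 0 < ε := sub_pos.2 (hpr k₀)
    refine ⟨(‖cross p q‖ / (l2norm p * ε) + l2norm q) / l2norm p, fun τ k h => ?_⟩
    rw [hvZ] at h
    have h2 := projDist_triangle hp (hv τ) (hZ k)
    have h3 : ε ≤ projDist p (v τ) := by simp only [ε]; linarith [hk₀ k]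
    have h4 : cross p (v τ) = cross p q := by simp only [v, cross]; simp; ring
    have h5 := l2norm_pos (hv τ)
    rw [projDist, h4, le_div_iff₀ (by positivity)] at h3
    have h6 : l2norm (v τ) ≤ ‖cross p q‖ / (l2norm p * ε) := by
      rw [le_div_iff₀ (by positivity)]; linarith
    have h7 := l2norm_sub_le (v τ) q
    simp only [v, add_sub_cancel_left, l2norm_smul] at h7
    rw [le_div_iff₀ hp0]
    exact h7.trans (by simpa [v] using h6)
  obtain ⟨R, hR⟩ := hbdd
  obtain ⟨π, hπ⟩ := exists_perm_of_path (d := fun τ τ' => projDist (v τ) (v τ'))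
    (z := fun k => coord (Z k)) (w := fun k => coord (Y k)) (r := r) (R := R) (f := f)
    (by
      refine Continuous.div ?_ ?_ fun x => (mul_pos (l2norm_pos (hv _)) (l2norm_pos (hv _))).ne'
      · simp only [cross]; fun_prop
      · exact (hl2.comp (by fun_prop)).mul (hl2.comp (by fun_prop)))
    (fun x => projDist_self _) (fun x y => projDist_comm _ _)
    (fun x y w => projDist_triangle (hv x) (hv y) (hv w)) hr hR
    (by
      refine Continuous.div ?_ ?_ fun x => hP _
      · refine Continuous.matrix_det ?_
        fun_prop
      · refine Continuous.matrix_det ?_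
        fun_prop)
    (fun t => by
      -- With `M = p 0 • A t - p 1 • B t` invertible, `f t` is the characteristic polynomial of
      -- `-M⁻¹ (q 0 • A t - q 1 • B t)`.
      obtain ⟨w, hw⟩ := exists_isEigenvalueList
        (-((p 0 • A t - p 1 • B t)⁻¹ * (q 0 • A t - q 1 • B t)))
      refine ⟨w, fun τ => ?_⟩
      rw [← eval_charpoly_eq_prod hw, Matrix.eval_charpoly]
      simp only [f]
      rw [div_eq_iff (hP t), mul_comm]
      simp only [P]
      rw [← Matrix.det_mul]
      congr 1
      have h2 : (p 0 • A t - p 1 • B t) * Matrix.scalar (Fin K) τ =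
          τ • (p 0 • A t - p 1 • B t) := by
        ext i j
        simp only [Matrix.scalar_apply, Matrix.mul_diagonal, Matrix.smul_apply, smul_eq_mul]
        ring
      rw [sub_neg_eq_add, Matrix.mul_add,
        Matrix.mul_nonsing_inv_cancel_left _ _ (Ne.isUnit (hP t)), h2]
      ext i j
      simp [v]
      ring)
    hf0 hf1 hclose'
  refine ⟨π, fun k => ?_⟩
  have := hπ k
  rwa [hvZ, hcoord _ (hYp _), projDist_smul_left (div_ne_zero hpq (hYp _))] at this

lemma eval_pencilPoly (A B : Matrix (Fin K) (Fin K) ℂ) (x : ℂ) :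
    (pencilPoly A B).eval x = (B - x • A).det := by
  rw [pencilPoly, ← Polynomial.coe_evalRingHom, RingHom.map_det]
  congr 1
  ext i j
  simp
  ring

/-- The homogeneous factorization of the determinant of a pencil. -/
lemma exists_det_pencil_eq {A B : Matrix (Fin K) (Fin K) ℂ} {w : Fin K → OnePoint ℂ}
    (hw : IsGenEigenvalueList A B w) :
    ∃ c : ℂ, ∀ x : Fin 2 → ℂ, (x 0 • A - x 1 • B).det = c * ∏ i, cross x (homogeneous (w i)) := by
  set Q := pencilPoly A B with hQ
  have hsplit := IsAlgClosed.splits Q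
  have hdeg : K = Q.natDegree + (K - Q.natDegree) := by
    have := congrArg Multiset.card hw
    rw [← hQ] at this
    simpa [hsplit.natDegree_eq_card_roots] using this
  have hprod : ∀ x : Fin 2 → ℂ, ∏ i, cross x (homogeneous (w i)) =
      (Q.roots.map fun c => x 0 - x 1 * c).prod * (-x 1) ^ (K - Q.natDegree) := by
    intro x
    have h1 : ∏ i, cross x (homogeneous (w i)) =
        ((Finset.univ.val.map w).map fun y => cross x (homogeneous y)).prod := by
      rw [Multiset.map_map]; rfl
    rw [h1, hw, Multiset.map_add, Multiset.prod_add, Multiset.map_replicate, Multiset.prod_replicate,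
      Multiset.map_map, ← hQ]
    congr 2
    · refine Multiset.map_congr rfl fun c _ => ?_
      simp [homogeneous, cross]
    · simp [homogeneous, cross]
  refine ⟨(-1) ^ Q.natDegree * Q.leadingCoeff, ?_⟩
  have hne : ∀ a b : ℂ, b ≠ 0 → (a • A - b • B).det = (-1) ^ Q.natDegree * Q.leadingCoeff *
      ((Q.roots.map fun c => a - b * c).prod * (-b) ^ (K - Q.natDegree)) := by
    intro a b hb
    have h1 : a • A - b • B = (-b) • (B - (a / b) • A) := by
      rw [smul_sub, smul_smul, neg_smul]
      have : -b * (a / b) = -a := by field_simp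
      rw [this, neg_smul]
      abel
    have h2 : (Q.roots.map fun c => a - b * c).prod =
        b ^ Q.natDegree * (Q.roots.map fun c => a / b - c).prod := by
      have : (fun c => a - b * c) = fun c => b * (a / b - c) := by
        ext c
        field_simp
      rw [this, Multiset.prod_map_mul, Multiset.map_const', Multiset.prod_replicate,
        hsplit.natDegree_eq_card_roots]
    rw [h1, Matrix.det_smul, Fintype.card_fin, ← eval_pencilPoly, ← hQ,
      hsplit.eval_eq_prod_roots, h2]
    conv_lhs => rw [hdeg, pow_add, neg_pow]
    ring
  intro x
  rw [hprod]
  -- Dehomogenizing needs `b ≠ 0`; the point `b = 0` follows by continuity.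
  have hcont := Continuous.ext_on (dense_compl_singleton (0 : ℂ))
    (f := fun b => (x 0 • A - b • B).det)
    (g := fun b => (-1) ^ Q.natDegree * Q.leadingCoeff *
      ((Q.roots.map fun c => x 0 - b * c).prod * (-b) ^ (K - Q.natDegree)))
    (Continuous.matrix_det (by fun_prop)) (by fun_prop) (fun b hb => hne (x 0) b hb)
  exact congrFun hcont (x 1)

end Pencil

/-! ### The matrix pencil method -/

section MatrixPencil

variable {K N : ℕ}

lemma hankel_conjTranspose {n : ℕ} (L M : ℕ) (h : L + M = n + 1) (x : Fin n → ℂ) :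
    (hankel L M h x)ᴴ = hankel M L (by omega) (star x) := by
  ext i j
  simp [hankel, Matrix.conjTranspose_apply, add_comm]

lemma l2norm_dropLast_le (x : Fin N → ℂ) : l2norm (dropLast x) ≤ l2norm x :=
  l2norm_comp_le (g := fun n : Fin (N - 1) => (⟨(n : ℕ), by omega⟩ : Fin N))
    (fun a b hab => by simpa [Fin.ext_iff] using hab) x

lemma l2norm_dropFirst_le (x : Fin N → ℂ) : l2norm (dropFirst x) ≤ l2norm x :=
  l2norm_comp_le (g := fun n : Fin (N - 1) => (⟨(n : ℕ) + 1, by omega⟩ : Fin N))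
    (fun a b hab => by simpa [Fin.ext_iff] using hab) x

lemma dropLast_measurements (z α : Fin K → ℂ) (e : EuclideanSpace ℂ (Fin N)) :
    dropLast (measurements z α e) =
      (fun i : Fin (N - 1) => ∑ k, α k * z k ^ (i : ℕ)) + dropLast e.ofLp := rfl

/-- Shifting only changes the amplitudes to `α k * z k`, so both Hankel matrices share their
Vandermonde factors. -/
lemma dropFirst_measurements (z α : Fin K → ℂ) (e : EuclideanSpace ℂ (Fin N)) :
    dropFirst (measurements z α e) =
      (fun i : Fin (N - 1) => ∑ k, α k * z k * z k ^ (i : ℕ)) + dropFirst e.ofLp := by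
  ext i
  simp [dropFirst, measurements, pow_succ', mul_assoc]

lemma norm_add_norm_le_l2norm (x : Fin 2 → ℂ) : ‖x 0‖ + ‖x 1‖ ≤ √2 * l2norm x := by
  refine le_of_sq_le_sq ?_ (mul_nonneg (Real.sqrt_nonneg _) (l2norm_nonneg _))
  rw [mul_pow, Real.sq_sqrt (by norm_num), l2norm_sq, Fin.sum_univ_two]
  linarith [sq_nonneg (‖x 0‖ - ‖x 1‖)]

lemma diagonal_pencil_eq (F G : Matrix (Fin K) (Fin K) ℂ) (z α : Fin K → ℂ) (x : Fin 2 → ℂ) :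
    x 0 • (F * Matrix.diagonal α * G) - x 1 • (F * Matrix.diagonal (fun k => α k * z k) * G) =
      F * Matrix.diagonal (fun k => α k * (x 0 - x 1 * z k)) * G := by
  suffices h : Matrix.diagonal (fun k => α k * (x 0 - x 1 * z k)) =
      x 0 • Matrix.diagonal α - x 1 • Matrix.diagonal fun k => α k * z k by
    rw [h, Matrix.mul_sub, Matrix.sub_mul]
    simp only [Matrix.mul_smul, Matrix.smul_mul]
  ext i j
  by_cases hij : i = j
  · subst hij; simp; ring
  · simp [hij]

/-- The generalized eigenvalues of a perturbation of the pencil `(F D G, F D diag(z) G)` lie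
close to `z`. -/
lemma exists_projDist_le {F G D₁ D₂ : Matrix (Fin K) (Fin K) ℂ} {z α : Fin K → ℂ}
    {f g a A η : ℝ} (hf : 0 < f) (hg : 0 < g) (ha : 0 < a) (hA : 0 ≤ A) (hη : 0 ≤ η)
    (hF : ∀ x, f * l2norm x ≤ l2norm (F *ᵥ x)) (hG : ∀ x, g * l2norm x ≤ l2norm (G *ᵥ x))
    (hα : ∀ k, a ≤ ‖α k‖) (hzA : ∀ k, A ≤ ‖z k‖)
    (hD₁ : ∀ x, l2norm (D₁ *ᵥ x) ≤ η * l2norm x) (hD₂ : ∀ x, l2norm (D₂ *ᵥ x) ≤ η * l2norm x)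
    (t : unitInterval) {x : Fin 2 → ℂ} (hx : x ≠ 0)
    (hdet : (x 0 • (F * Matrix.diagonal α * G + (t : ℂ) • D₁) -
      x 1 • (F * Matrix.diagonal (fun k => α k * z k) * G + (t : ℂ) • D₂)).det = 0) :
    ∃ k, projDist x (homogeneous (z k)) ≤ √2 * η / (a * f * g * √(1 + A ^ 2)) := by
  obtain ⟨v, hv, hv0⟩ := Matrix.exists_mulVec_eq_zero_iff.2 hdet
  have hv' := l2norm_pos hv
  have hx' := l2norm_pos hx
  have hne : Nonempty (Fin K) := by
    by_contra hemp
    rw [not_nonempty_iff] at hemp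
    exact hv (Subsingleton.elim _ _)
  obtain ⟨k, hk⟩ := Finite.exists_min fun k => ‖x 0 - x 1 * z k‖
  refine ⟨k, ?_⟩
  set μ := ‖x 0 - x 1 * z k‖
  let d : Fin K → ℂ := fun k => α k * (x 0 - x 1 * z k)
  have h1 : F *ᵥ (Matrix.diagonal d *ᵥ (G *ᵥ v)) =
      (-(t : ℂ)) • (x 0 • (D₁ *ᵥ v) - x 1 • (D₂ *ᵥ v)) := by
    have h2 := (diagonal_pencil_eq F G z α x).symm
    rw [Matrix.mulVec_mulVec, Matrix.mulVec_mulVec, h2]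
    have h3 : ∀ P Q : Matrix (Fin K) (Fin K) ℂ, (x 0 • (P + (t : ℂ) • D₁) -
        x 1 • (Q + (t : ℂ) • D₂)) *ᵥ v = (x 0 • P - x 1 • Q) *ᵥ v +
          (t : ℂ) • (x 0 • (D₁ *ᵥ v) - x 1 • (D₂ *ᵥ v)) := by
      intro P Q
      simp only [smul_add, Matrix.sub_mulVec, Matrix.add_mulVec, Matrix.smul_mulVec, smul_sub]
      rw [smul_comm (x 0) (t : ℂ), smul_comm (x 1) (t : ℂ)]
      abel
    rw [h3] at hv0
    rw [neg_smul]
    exact eq_neg_of_add_eq_zero_left hv0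
  have h4 : a * μ * l2norm (G *ᵥ v) ≤ l2norm (Matrix.diagonal d *ᵥ (G *ᵥ v)) :=
    le_l2norm_diagonal_mulVec (mul_nonneg ha.le (norm_nonneg _)) (fun i => by
      rw [norm_mul]
      exact mul_le_mul (hα i) (hk i) (norm_nonneg _) (norm_nonneg _)) _
  -- The factor `√2` is the price of `‖x 0‖ + ‖x 1‖` against the Euclidean norm.
  have h5 : l2norm (F *ᵥ (Matrix.diagonal d *ᵥ (G *ᵥ v))) ≤ √2 * l2norm x * η * l2norm v := by
    rw [h1, l2norm_smul, norm_neg]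
    have h6 : ‖(t : ℂ)‖ ≤ 1 := by
      rw [Complex.norm_real, Real.norm_of_nonneg t.2.1]; exact t.2.2
    refine (mul_le_of_le_one_left (l2norm_nonneg _) h6).trans ((l2norm_sub_le _ _).trans ?_)
    rw [l2norm_smul, l2norm_smul]
    have h7 := mul_le_mul_of_nonneg_left (hD₁ v) (norm_nonneg (x 0))
    have h8 := mul_le_mul_of_nonneg_left (hD₂ v) (norm_nonneg (x 1))
    have h9 := mul_le_mul_of_nonneg_right (norm_add_norm_le_l2norm x)
      (mul_nonneg hη hv'.le)
    linarith
  have hμ : 0 ≤ μ := norm_nonneg _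
  have h10 : f * (a * μ * (g * l2norm v)) ≤ √2 * l2norm x * η * l2norm v := by
    refine le_trans ?_ ((hF _).trans h5)
    refine mul_le_mul_of_nonneg_left (le_trans ?_ h4) hf.le
    exact mul_le_mul_of_nonneg_left (hG v) (mul_nonneg ha.le hμ)
  have h11 : μ * (a * f * g) ≤ √2 * η * l2norm x := by
    refine le_of_mul_le_mul_right ?_ hv'
    linarith
  have h12 : √(1 + A ^ 2) ≤ l2norm (homogeneous (z k)) := by
    rw [l2norm_fin_two]
    refine Real.sqrt_le_sqrt ?_
    have := pow_le_pow_left₀ hA (hzA k) 2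
    simp only [homogeneous, Matrix.cons_val_zero, Matrix.cons_val_one, norm_one]
    linarith
  have h13 : cross x (homogeneous (z k)) = x 0 - x 1 * z k := by
    simp [cross, homogeneous]
  have h14 : 0 < √(1 + A ^ 2) := Real.sqrt_pos.2 (by positivity)
  rw [projDist, h13, div_le_div_iff₀ (mul_pos hx' (h14.trans_le h12)) (by positivity)]
  have h15 := mul_le_mul h11 h12 h14.le (by positivity)
  calc μ * (a * f * g * √(1 + A ^ 2)) = μ * (a * f * g) * √(1 + A ^ 2) := by ring
    _ ≤ _ := h15
    _ = _ := by ring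

/-- As `√(1 + A²) ≤ √2` and `ρ ≥ 1`, the first summand of the bound alone is at least `2 s` with `s
= γ / (1 - γ)`. A bound below `1` thus gives `s < 1/2`, so `1 - s² ≥ 3/4`, and the inclusion radius
is absorbed by that summand. -/
lemma matrix_pencil_radius_le {K : ℕ} (hK : 0 < K) {γ ρ A : ℝ} (hγ0 : 0 ≤ γ) (hγ : γ < 1)
    (hρ : 1 ≤ ρ) (hA0 : 0 ≤ A) (hA1 : A ≤ 1)
    (hlt : (2 * (K : ℝ) - 1) * γ / √(1 + A ^ 2) *
      (2 * √2 / (1 - γ) * ρ + (1 + √2 * γ / (1 - γ))) < 1) :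
    γ / (1 - γ) < 1 / 2 ∧ (2 * (K : ℝ) - 1) * (√2 * γ / ((1 - (γ / (1 - γ)) ^ 2) * √(1 + A ^ 2))) ≤
      (2 * (K : ℝ) - 1) * γ / √(1 + A ^ 2) *
        (2 * √2 / (1 - γ) * ρ + (1 + √2 * γ / (1 - γ))) := by
  have hK1 : (1 : ℝ) ≤ 2 * K - 1 := by
    have : (1 : ℝ) ≤ K := by exact_mod_cast hK
    linarith
  have h1γ : 0 < 1 - γ := by linarith
  have hq0 : 0 < √2 := Real.sqrt_pos.2 (by norm_num)
  have hq2 : √2 ^ 2 = 2 := Real.sq_sqrt (by norm_num)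
  set q := √2
  have hb0 : 0 < √(1 + A ^ 2) := Real.sqrt_pos.2 (by positivity)
  have hbq : √(1 + A ^ 2) ≤ q := Real.sqrt_le_sqrt (by nlinarith)
  set b := √(1 + A ^ 2)
  set s := γ / (1 - γ)
  have hs0 : 0 ≤ s := div_nonneg hγ0 h1γ.le
  have h1 : 2 * q / (1 - γ) ≤ 2 * q / (1 - γ) * ρ + (1 + q * γ / (1 - γ)) := by
    have h2 : 2 * q / (1 - γ) * 1 ≤ 2 * q / (1 - γ) * ρ := by gcongr
    have h3 : 0 ≤ q * γ / (1 - γ) := by positivity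
    linarith
  have hfac : γ / b ≤ (2 * (K : ℝ) - 1) * γ / b := by
    gcongr
    nlinarith
  have hs : s < 1 / 2 := by
    have h2 : γ / q ≤ γ / b := by gcongr
    have h3 : γ / q * (2 * q / (1 - γ)) ≤ (2 * (K : ℝ) - 1) * γ / b *
        (2 * q / (1 - γ) * ρ + (1 + q * γ / (1 - γ))) :=
      mul_le_mul (h2.trans hfac) h1 (by positivity) (by positivity)
    have h4 : γ / q * (2 * q / (1 - γ)) = 2 * s := by
      simp only [s]; field_simp
    linarith
  refine ⟨hs, ?_⟩
  have hc2 : 3 / 4 ≤ 1 - s ^ 2 := by nlinarith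
  set C := 1 - s ^ 2
  have h5 : q / C ≤ 2 * q / (1 - γ) := by
    rw [div_le_div_iff₀ (by linarith) h1γ]
    nlinarith
  have h6 : (2 * (K : ℝ) - 1) * (q * γ / (C * b)) = (2 * (K : ℝ) - 1) * γ / b * (q / C) := by
    have : C ≠ 0 := by linarith
    field_simp
  rw [h6]
  exact mul_le_mul_of_nonneg_left (h5.trans h1) (by positivity)

theorem matrix_pencil_main {L : ℕ} (hK : 0 < K) (hKL : K ≤ L) (hLN : L + K ≤ N) {z : Fin K → ℂ}
    (hz : Function.Injective z) {α : Fin K → ℂ} (e : EuclideanSpace ℂ (Fin N)) {a b A : ℝ}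
    (ha : 0 < a) (haα : ∀ k, a ≤ ‖α k‖) (hab : a ≤ b) (hA0 : 0 ≤ A) (hA1 : A ≤ 1)
    (hzA : ∀ k, A ≤ ‖z k‖) {γ : ℝ}
    (hγ : γ = √(min L (N - L) : ℕ) * ‖e‖ /
      (a * sigmaMin (vand L z) * sigmaMin (vand (N - L) z)))
    (hγ1 : γ < 1) {w : Fin K → OnePoint ℂ}
    (hw : IsRegularMP K L hK hKL hLN (measurements z α e) w) :
    ∃ π : Equiv.Perm (Fin K), ∀ k, chordal (w (π k)) (z k) ≤
      (2 * (K : ℝ) - 1) * γ / √(1 + A ^ 2) *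
        (2 * √2 / (1 - γ) * (b / a) * kappa (vand L z) * kappa (vand (N - L) z) +
          (1 + √2 * γ / (1 - γ))) := by
  obtain ⟨U, s, W, X₁, X₂, Ψ₁, Ψ₂, hX₁, hX₂, hsvd, hΨ₁, hΨ₂, -, hw⟩ := hw
  have hKM : K ≤ N - L := by omega
  have hm := sigmaMin_vand_pos hK hKL hz
  have hm₂ := sigmaMin_vand_pos hK hKM hz
  have hVm := sigmaMin_mul_l2norm_le hKL (vand L z)
  have hVm₂ := sigmaMin_vand_mul_le_star hKM z
  have hρ : 1 ≤ b / a * kappa (vand L z) * kappa (vand (N - L) z) := by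
    have h1 : 1 ≤ b / a := (one_le_div ha).2 hab
    have h2 : 1 ≤ kappa (vand L z) := (one_le_div hm).2 (sigmaMin_le_sigmaMax _)
    have h3 : 1 ≤ kappa (vand (N - L) z) := (one_le_div hm₂).2 (sigmaMin_le_sigmaMax _)
    exact one_le_mul_of_one_le_of_one_le (one_le_mul_of_one_le_of_one_le h1 h2) h3
  rw [show 2 * √2 / (1 - γ) * (b / a) * kappa (vand L z) * kappa (vand (N - L) z) =
    2 * √2 / (1 - γ) * (b / a * kappa (vand L z) * kappa (vand (N - L) z)) by ring]
  set ρ := b / a * kappa (vand L z) * kappa (vand (N - L) z)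
  set m := sigmaMin (vand L z)
  set m₂ := sigmaMin (vand (N - L) z)
  have hσ : 0 < a * m * m₂ := by positivity
  have hγ0 : 0 ≤ γ := by rw [hγ]; positivity
  -- Chordal distances never exceed `1`, so only a bound below `1` needs proof.
  rcases le_or_gt 1 ((2 * (K : ℝ) - 1) * γ / √(1 + A ^ 2) *
    (2 * √2 / (1 - γ) * ρ + (1 + √2 * γ / (1 - γ)))) with hbig | hlt
  · exact ⟨1, fun k => by
      rw [chordal_eq_projDist]
      exact (projDist_le_one _ _).trans hbig⟩
  set S := firstCols K hKL U
  set R := firstCols K hKM W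
  set V := vand L z
  set V' := vand (N - L) (star z)
  let E₁ := hankel L (N - L) (by omega) (dropLast e.ofLp)
  let E₂ := hankel L (N - L) (by omega) (dropFirst e.ofLp)
  have hX₁' : X₁ = V * Matrix.diagonal α * V'ᴴ + E₁ := by
    rw [hX₁, dropLast_measurements, hankel_add, hankel_exponential_sum]
  have hX₂' : X₂ = V * Matrix.diagonal (fun k => α k * z k) * V'ᴴ + E₂ := by
    rw [hX₂, dropFirst_measurements, hankel_add,
      hankel_exponential_sum (α := fun k => α k * z k)]
  have hE₁ : ∀ u, l2norm (E₁ *ᵥ u) ≤ γ * (a * m * m₂) * l2norm u :=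
    l2norm_hankel_noise_le _ hσ (l2norm_dropLast_le e.ofLp) hγ
  have hE₂ : ∀ u, l2norm (E₂ *ᵥ u) ≤ γ * (a * m * m₂) * l2norm u :=
    l2norm_hankel_noise_le _ hσ (l2norm_dropFirst_le e.ofLp) hγ
  have hE₁' : ∀ u, l2norm (E₁ᴴ *ᵥ u) ≤ γ * (a * m₂ * m) * l2norm u := by
    rw [hankel_conjTranspose]
    refine l2norm_hankel_noise_le (e := star (dropLast e.ofLp)) _ (by positivity) ?_
      (by rw [min_comm, mul_right_comm a]; exact hγ)
    rw [l2norm_star]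
    exact l2norm_dropLast_le e.ofLp
  -- The adjoint decomposition yields the projection of the right singular vectors onto the range of
  -- `V'`.
  have hsvd' := hsvd.conjTranspose
  rw [hX₁'] at hsvd
  rw [hX₁', Matrix.conjTranspose_add, Matrix.conjTranspose_mul, Matrix.conjTranspose_mul,
    Matrix.conjTranspose_conjTranspose, Matrix.diagonal_conjTranspose, ← Matrix.mul_assoc] at hsvd'
  obtain ⟨T, horth, hsin⟩ := hsvd.exists_projection hKL hKM hm hm₂ ha hVm hVm₂ haα hγ0 hγ1 hE₁
  obtain ⟨T', horth', hsin'⟩ := hsvd'.exists_projection hKM hKL hm₂ hm ha hVm₂ hVm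
    (fun k => by simpa using haα k) hγ0 hγ1 hE₁'
  have hS := firstCols_conjTranspose_mul_self hKL hsvd.unitary_left
  have hR := firstCols_conjTranspose_mul_self hKM hsvd.unitary_right
  have hs0 : 0 ≤ γ / (1 - γ) := div_nonneg hγ0 (by linarith)
  obtain ⟨hs2, hbound⟩ := matrix_pencil_radius_le hK hγ0 hγ1 hρ hA0 hA1 hlt
  set t := γ / (1 - γ)
  have hc2 : 0 < 1 - t ^ 2 := by nlinarith
  have hc := Real.sqrt_pos.2 hc2
  have hcsq : √(1 - t ^ 2) ^ 2 = 1 - t ^ 2 := Real.sq_sqrt hc2.le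
  set c := √(1 - t ^ 2)
  have htc : t ^ 2 + c ^ 2 = 1 := by rw [hcsq]; ring
  have hb0 : 0 < √(1 + A ^ 2) := Real.sqrt_pos.2 (by positivity)
  have hG : ∀ x, m₂ * c * l2norm x ≤ l2norm ((V'ᴴ * R) *ᵥ x) :=
    le_l2norm_conjTranspose_mul_mulVec hR horth' htc hsin' hm₂.le hVm₂
  have hF : ∀ x, m * c * l2norm x ≤ l2norm ((Sᴴ * V) *ᵥ x) := by
    intro x
    -- The estimate is available for `Vᴴ S`; this matrix is square, so its adjoint inherits it.
    have := le_l2norm_conjTranspose_mulVec (mul_pos hm hc)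
      (le_l2norm_conjTranspose_mul_mulVec hS horth htc hsin hm.le hVm) x
    rwa [Matrix.conjTranspose_mul, Matrix.conjTranspose_conjTranspose] at this
  have hD : ∀ E : Matrix (Fin L) (Fin (N - L)) ℂ,
      (∀ u, l2norm (E *ᵥ u) ≤ γ * (a * m * m₂) * l2norm u) →
      ∀ u, l2norm ((Sᴴ * E * R) *ᵥ u) ≤ γ * (a * m * m₂) * l2norm u := by
    intro E hE u
    rw [← Matrix.mulVec_mulVec, ← Matrix.mulVec_mulVec]
    refine (l2norm_conjTranspose_mulVec_le hS _).trans ((hE _).trans_eq ?_)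
    rw [l2norm_mulVec_of_conjTranspose_mul_self hR]
  have hΨ₁' : Ψ₁ = Sᴴ * V * Matrix.diagonal α * (V'ᴴ * R) + Sᴴ * E₁ * R := by
    rw [hΨ₁, hX₁']
    simp only [Matrix.mul_add, Matrix.add_mul, Matrix.mul_assoc]
  have hΨ₂' : Ψ₂ = Sᴴ * V * Matrix.diagonal (fun k => α k * z k) * (V'ᴴ * R) + Sᴴ * E₂ * R := by
    rw [hΨ₂, hX₂']
    simp only [Matrix.mul_add, Matrix.add_mul, Matrix.mul_assoc]
  obtain ⟨c₁, hc₁⟩ := exists_det_pencil_eq hw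
  obtain ⟨π, hπ⟩ := exists_perm_projDist_le hK
    (A := fun t => Sᴴ * V * Matrix.diagonal α * (V'ᴴ * R) + ((t : ℝ) : ℂ) • (Sᴴ * E₁ * R))
    (B := fun t => Sᴴ * V * Matrix.diagonal (fun k => α k * z k) * (V'ᴴ * R) +
      ((t : ℝ) : ℂ) • (Sᴴ * E₂ * R)) (by fun_prop) (by fun_prop)
    (Z := fun k => homogeneous (z k)) (Y := fun k => homogeneous (w k))
    -- From `exists_projDist_le` with lower bounds `m c` and `m₂ c`: the noise level `γ a m m₂`
    -- cancels all but `c² = 1 - t²`.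
    (fun k => homogeneous_ne_zero _) (r := √2 * γ / ((1 - t ^ 2) * √(1 + A ^ 2))) (by positivity)
    (hbound.trans_lt hlt) (fun τ x hx hdet => by
      obtain ⟨k, hk⟩ := exists_projDist_le (mul_pos hm hc) (mul_pos hm₂ hc) ha hA0
        (mul_nonneg hγ0 hσ.le) hF hG haα hzA (hD E₁ hE₁) (hD E₂ hE₂) τ hx hdet
      refine ⟨k, hk.trans_eq ?_⟩
      rw [← hcsq]
      field_simp)
    (c₀ := (Sᴴ * V).det * (∏ k, α k) * (V'ᴴ * R).det) (fun x => by
      simp only [Set.Icc.coe_zero, Complex.ofReal_zero, zero_smul, add_zero]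
      rw [diagonal_pencil_eq, Matrix.det_mul, Matrix.det_mul, Matrix.det_diagonal, Finset.prod_mul_distrib]
      have h2 : ∀ k, cross x (homogeneous (z k)) = x 0 - x 1 * z k := fun k => by
        simp [cross, homogeneous]
      simp only [h2]
      ring)
    (c₁ := c₁) (fun x => by
      simp only [Set.Icc.coe_one, Complex.ofReal_one, one_smul]
      rw [← hΨ₁', ← hΨ₂', hc₁])
  exact ⟨π, fun k => by
    rw [chordal_eq_projDist]
    exact (hπ k).trans hbound⟩

end MatrixPencil

end SubspaceMethods

theorem theorem1 (K L N : ℕ) (hK : 0 < K) (hKL : K ≤ L) (hLN : L + K ≤ N)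
    (z : Fin K → ℂ) (hz : Function.Injective z) (hz1 : ∀ k, ‖z k‖ ≤ 1)
    (α : Fin K → ℂ) (hα : ∀ k, α k ≠ 0)
    (e : EuclideanSpace ℂ (Fin N))
    (αmin αmax Amin : ℝ) (hαmin : αmin = ⨅ k, ‖α k‖) (hαmax : αmax = ⨆ k, ‖α k‖)
    (hAmin : Amin = ⨅ k, ‖z k‖) :
    (K + 1 ≤ L →
      ∀ β γ : ℝ,
        β = sigmaMax (vand L z) / sigmaMin (vand (L - 1) z) →
        γ = √(min L (N - L + 1) : ℕ) * ‖e‖ /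
          (αmin * sigmaMin (vand L z) * sigmaMin (vand (N - L + 1) z)) →
        γ < 1 / (1 + √2 * β) →
        ∀ zhat : Fin K → ℂ,
          IsEsprit K L hKL hLN (measurements z α e) zhat →
          ∃ π : Equiv.Perm (Fin K), ∀ k,
            ‖zhat (π k) - z k‖ ≤
              (2 * (K : ℝ) - 1) * √2 * β * γ / (1 - (1 + √2 * β) * γ) *
                ((1 + kappa (vand L z)) * kappa (vand L z))) ∧
    (∀ γ : ℝ,
        γ = √(min L (N - L) : ℕ) * ‖e‖ /
          (αmin * sigmaMin (vand L z) * sigmaMin (vand (N - L) z)) →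
        γ < 1 →
        ∀ zhat : Fin K → OnePoint ℂ,
          IsRegularMP K L hK hKL hLN (measurements z α e) zhat →
          ∃ π : Equiv.Perm (Fin K), ∀ k,
            chordal (zhat (π k)) (z k) ≤
              (2 * (K : ℝ) - 1) * γ / √(1 + Amin ^ 2) *
                (2 * √2 / (1 - γ) * (αmax / αmin) * kappa (vand L z) * kappa (vand (N - L) z) +
                  (1 + √2 * γ / (1 - γ)))) := by
  have hne : Nonempty (Fin K) := ⟨⟨0, hK⟩⟩
  have hbdd : ∀ f : Fin K → ℝ, BddBelow (Set.range f) := fun f => (Set.finite_range f).bddBelow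
  have hα0 : 0 < αmin := by
    obtain ⟨k, hk⟩ := exists_eq_ciInf_of_finite (f := fun k => ‖α k‖)
    rw [hαmin, ← hk]
    exact norm_pos_iff.2 (hα k)
  have hαle : ∀ k, αmin ≤ ‖α k‖ := fun k => hαmin ▸ ciInf_le (hbdd _) k
  have hzle : ∀ k, Amin ≤ ‖z k‖ := fun k => hAmin ▸ ciInf_le (hbdd _) k
  have hA0 : 0 ≤ Amin := hAmin ▸ Real.iInf_nonneg fun k => norm_nonneg _
  have hαmm : αmin ≤ αmax := (hαle ⟨0, hK⟩).trans
    (hαmax ▸ le_ciSup (f := fun k => ‖α k‖) (Set.finite_range _).bddAbove ⟨0, hK⟩)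
  refine ⟨fun hL β γ hβ hγ hγ1 zhat hzhat => ?_, fun γ hγ hγ1 zhat hzhat => ?_⟩
  · exact esprit_main hK hKL hLN hz hz1 e hα0 hαle hL hβ hγ hγ1 hzhat
  · exact matrix_pencil_main hK hKL hLN hz e hα0 hαle hαmm hA0
      ((hzle ⟨0, hK⟩).trans (hz1 _)) hzle hγ hγ1 hzhat
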